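/- For an integer $\alpha$ let $T_\alpha(z)=\sum_{m\ge 1} m^{m-\alpha}\frac{z^m}{m!}$ for complex $z$ with $|z|<1/e$, and write $T=T_1$ (the tree function). A \emph{Greg tree} of size $n$ is a finite tree in which $n$ vertices are labeled bijectively by $1,\dots,n$, the other vertices are unlabeled, and every unlabeled vertex has degree at least $3$. A \emph{rooted Greg tree} of size $n$ is a finite tree with $n$ vertices labeled by $1,\dots,n$ and the others unlabeled, together with a distinguished vertex (the root, labeled or not), such that every unlabeled vertex has degree at least $3$, except that an unlabeled root may also have degree $2$. Trees are considered up to isomorphisms preserving the labels (and the root, in the rooted case). Let $\mathcal G_n$ and $\mathcal G^\bullet_n$ be the sets of Greg trees and of rooted Greg trees of size $n$, and let $\mathrm{unl}(T)$ be the number of unlabeled vertices of such a tree $T$. Theorem. Let $n\ge 1$. The sets $\mathcal G_n$ and $\mathcal G^\bullet_n$ are finite. There are unique polynomials $G_n,H_n\in\mathbb C[x]$ such that for all complex $z$ with $|z|<1/e$ $$\frac{d^n}{dz^n}T_1(z)=\frac{e^{nT(z)}}{(1-T(z))^{n}}\,G_n\!\left(\frac{T(z)}{1-T(z)}\right),\qquad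 \frac{d^n}{dz^n}T_2(z)=\frac{e^{nT(z)}}{(1-T(z))^{n-1}}\,H_n\!\left(\frac{T(z)}{1-T(z)}\right),$$ and these polynomials are $$G_n(x)=\sum_{T\in\mathcal G^\bullet_n}x^{\mathrm{unl}(T)},\qquad H_n(x)=\sum_{T\in\mathcal G_n}x^{\mathrm{unl}(T)}.$$ -/

import Mathlib

open Polynomial

/-- The function `T_α(z) = ∑_{m ≥ 1} m^(m-α) z^m / m!`, as the sum of its power series
(which converges for `|z| < 1/e`); the index `k` of the sum stands for `m = k + 1`. -/
noncomputable def treeFun (α : ℤ) (z : ℂ) : ℂ :=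
  ∑' k : ℕ, ((k + 1 : ℕ) : ℂ) ^ (((k + 1 : ℕ) : ℤ) - α) * z ^ (k + 1) / (Nat.factorial (k + 1) : ℂ)

/-- `P` is a polynomial `G_n` with
`(d/dz)^n T_1(z) = exp(n T(z)) / (1 - T(z))^n * G_n (T(z) / (1 - T(z)))`, where `T = T_1`,
on the disc of convergence `|z| < 1/e`. -/
def IsGPoly (n : ℕ) (P : ℂ[X]) : Prop :=
  ∀ z : ℂ, ‖z‖ < Real.exp (-1) →
    iteratedDeriv n (treeFun 1) z =
      Complex.exp (n * treeFun 1 z) / (1 - treeFun 1 z) ^ n *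
        P.eval (treeFun 1 z / (1 - treeFun 1 z))

/-- `P` is a polynomial `H_n` (for `n ≥ 1`) with
`(d/dz)^n T_2(z) = exp(n T(z)) / (1 - T(z))^(n-1) * H_n (T(z) / (1 - T(z)))`, where `T = T_1`,
on the disc of convergence `|z| < 1/e`. -/
def IsHPoly (n : ℕ) (P : ℂ[X]) : Prop :=
  ∀ z : ℂ, ‖z‖ < Real.exp (-1) →
    iteratedDeriv n (treeFun 2) z =
      Complex.exp (n * treeFun 1 z) / (1 - treeFun 1 z) ^ (n - 1) *
        P.eval (treeFun 1 z / (1 - treeFun 1 z))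

open Classical in
/-- A concrete Greg tree of size `n`: a tree whose labeled vertices are the `inl i`, one for each
of the `n` labels, and whose `unl` unlabeled vertices are the `inr j`, each of degree at least 3.
The names `j` of the unlabeled vertices are forgotten in `GregTree` below. -/
structure GregTreeRep (n : ℕ) where
  unl : ℕ
  graph : SimpleGraph (Fin n ⊕ Fin unl)
  isTree : graph.IsTree
  three_le_degree : ∀ j : Fin unl, 3 ≤ graph.degree (Sum.inr j)

/-- Two concrete Greg trees are identified when they are isomorphic by a graph isomorphism that
respects the labels. -/
instance GregTreeRep.setoid (n : ℕ) : Setoid (GregTreeRep n) where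
  r T T' := ∃ φ : T.graph ≃g T'.graph, ∀ i : Fin n, φ (Sum.inl i) = Sum.inl i
  iseqv :=
    { refl := fun _ => ⟨SimpleGraph.Iso.refl, fun _ => rfl⟩
      symm := by
        rintro T T' ⟨φ, h⟩
        exact ⟨φ.symm, fun i => by rw [RelIso.symm_apply_eq, h]⟩
      trans := by
        rintro T T' T'' ⟨φ, h⟩ ⟨ψ, h'⟩
        exact ⟨φ.trans ψ, fun i => by rw [RelIso.trans_apply, h, h']⟩ }

/-- The set of Greg trees of size `n`. -/
def GregTree (n : ℕ) : Type := Quotient (GregTreeRep.setoid n)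

/-- The number of unlabeled vertices of a Greg tree. -/
def GregTree.unl {n : ℕ} (T : GregTree n) : ℕ :=
  Quotient.lift GregTreeRep.unl (by
    rintro T T' ⟨φ, -⟩
    have h := Fintype.card_congr φ.toEquiv
    simpa using h) T

open Classical in
/-- A concrete rooted Greg tree of size `n`: as for Greg trees, with a distinguished vertex, the
root (labeled or not); if the root is unlabeled, it may also have degree 2. -/
structure RootedGregTreeRep (n : ℕ) where
  unl : ℕ
  graph : SimpleGraph (Fin n ⊕ Fin unl)
  root : Fin n ⊕ Fin unl
  isTree : graph.IsTree
  degree_cond : ∀ j : Fin unl,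
    3 ≤ graph.degree (Sum.inr j) ∨ (root = Sum.inr j ∧ graph.degree (Sum.inr j) = 2)

/-- Two concrete rooted Greg trees are identified when they are isomorphic by a graph isomorphism
that respects the labels and the root. -/
instance RootedGregTreeRep.setoid (n : ℕ) : Setoid (RootedGregTreeRep n) where
  r T T' := ∃ φ : T.graph ≃g T'.graph,
    (∀ i : Fin n, φ (Sum.inl i) = Sum.inl i) ∧ φ T.root = T'.root
  iseqv :=
    { refl := fun _ => ⟨SimpleGraph.Iso.refl, fun _ => rfl, rfl⟩
      symm := by
        rintro T T' ⟨φ, h, hr⟩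
        exact ⟨φ.symm, fun i => by rw [RelIso.symm_apply_eq, h],
          by rw [RelIso.symm_apply_eq, hr]⟩
      trans := by
        rintro T T' T'' ⟨φ, h, hr⟩ ⟨ψ, h', hr'⟩
        exact ⟨φ.trans ψ, fun i => by rw [RelIso.trans_apply, h, h'],
          by rw [RelIso.trans_apply, hr, hr']⟩ }

/-- The set of rooted Greg trees of size `n`. -/
def RootedGregTree (n : ℕ) : Type := Quotient (RootedGregTreeRep.setoid n)

/-- The number of unlabeled vertices of a rooted Greg tree. -/
def RootedGregTree.unl {n : ℕ} (T : RootedGregTree n) : ℕ :=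
  Quotient.lift RootedGregTreeRep.unl (by
    rintro T T' ⟨φ, -⟩
    have h := Fintype.card_congr φ.toEquiv
    simpa using h) T

/-!
The proof compares two recurrences.

On the analytic side, `T = T_1` satisfies `(1 - T) T' = exp T`, and `T_2' = exp T`. Both follow from
the identity `T (w exp (-w)) = w` for small `w`: after expanding the exponentials, the coefficient
of `w ^ (N + 1)` is, up to a factorial, an `(N + 1)`-st finite difference of `m ↦ m ^ N`, hence zero
for `N ≥ 1`
(`treeFun_one_mul_exp_neg`); the identity theorem carries the differential equations to the whole
disc. With `x = T / (1 - T)`, differentiation of the asserted formulas gives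
`G_{n+1} = n (2 + x) G_n + (1 + x)² G_n'` and
`H_{n+1} = (2n - 1 + (n - 1) x) H_n + (1 + x)² H_n'` with `G_1 = H_1 = 1`
(`isGPoly_gPoly`, `isHPoly_hPoly`). Uniqueness holds because `x` takes infinitely many values.

On the combinatorial side, a rooted Greg tree is encoded by the family of its clusters, the sets of
labels at or below a vertex. Since an unlabeled vertex has at least two children, different vertices
have different clusters, the tree order is inclusion, and the family determines the tree up to
isomorphism (`RootedGregTreeRep.family_eq_iff`). The families that occur are the laminar families
`IsGregFamily` (`RootedGregTreeRep.exists_family_eq`), and the number of unlabeled vertices is the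
size of the family minus `n`. A family on `n + 1` labels arises in exactly one way by inserting the
label `n` at a member `S` of a family on `n` labels: `S` may be kept or not and `{n}` may be added
or not, but at least one of the two unless `S` carries no label (`insertLabel`,
`exists_eq_insertLabel`, `insertLabel_injective`). For a family of size `n + k` this contributes
`(n + k) (2 x^k + x^(k+1)) + k x^(k-1)`, which is the recurrence of `G_n` (`sum_gregFamilies`).

Unrooted Greg trees are the same as rooted ones whose root is the vertex labeled `0`, that is,
families in which only the full set contains `0`. In the insertion, `S` must then not be kept when
it is the full set, which gives the recurrence of `H_n` (`sum_gregFamilies_zeroTop`).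
-/

/-! ### The tree function near the origin -/

lemma summand_norm_le {α : ℤ} (hα : 0 ≤ α) (k : ℕ) (z : ℂ) :
    ‖((k + 1 : ℕ) : ℂ) ^ (((k + 1 : ℕ) : ℤ) - α) * z ^ (k + 1) / (Nat.factorial (k + 1) : ℂ)‖
      ≤ (Real.exp 1 * ‖z‖) ^ (k + 1) := by
  have h1 : (((k + 1 : ℕ) : ℝ)) ^ (((k + 1 : ℕ) : ℤ) - α) ≤ ((k + 1 : ℕ) : ℝ) ^ (k + 1) := by
    rw [← zpow_natCast]
    exact zpow_le_zpow_right₀ (by exact_mod_cast Nat.succ_pos k) (by omega)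
  have h2 := Real.pow_div_factorial_le_exp ((k + 1 : ℕ) : ℝ) (by positivity) (k + 1)
  rw [norm_div, norm_mul, norm_zpow, norm_pow, Complex.norm_natCast, Complex.norm_natCast, mul_pow,
    ← Real.exp_nat_mul, mul_one, mul_div_right_comm]
  gcongr
  exact (div_le_div_of_nonneg_right h1 (by positivity)).trans h2

lemma summable_geometric_succ {q : ℝ} (h0 : 0 ≤ q) (h1 : q < 1) :
    Summable fun k : ℕ => q ^ (k + 1) :=
  (summable_nat_add_iff 1).2 (summable_geometric_of_lt_one h0 h1)

/-- Up to a factor `(n + 1)!`, this sum is the `(n + 1)`-st finite difference of `m ↦ m ^ n` at `0`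
without its term `m = 0`. That difference vanishes, and the missing term is zero unless `n = 0`. -/
lemma sum_antidiagonal_pow_eq (n : ℕ) :
    ∑ p ∈ Finset.HasAntidiagonal.antidiagonal n,
      ((p.1 + 1 : ℕ) : ℂ) ^ n * (-1) ^ p.2 / ((p.1 + 1).factorial * p.2.factorial : ℂ)
      = if n = 0 then 1 else 0 := by
  rcases Nat.eq_zero_or_pos n with rfl | hn
  · simp
  rw [if_neg hn.ne']
  have h := congrFun (fwdDiff_iter_pow_eq_zero_of_lt (R := ℂ) (Nat.lt_succ_self n)) 0
  rw [fwdDiff_iter_eq_sum_shift, Finset.sum_range_succ'] at h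
  simp only [Nat.succ_eq_add_one, zero_add, nsmul_eq_mul, mul_one, Nat.cast_zero,
    zero_pow hn.ne', smul_zero, add_zero, Pi.zero_apply, zsmul_eq_mul] at h
  rw [Finset.Nat.sum_antidiagonal_eq_sum_range_succ
    (fun i j => ((i + 1 : ℕ) : ℂ) ^ n * (-1) ^ j / ((i + 1).factorial * j.factorial : ℂ))]
  have h3 : ((n + 1).factorial : ℂ) ≠ 0 := by exact_mod_cast (n + 1).factorial_ne_zero
  refine (mul_eq_zero.1 ?_).resolve_left h3
  rw [Finset.mul_sum, ← h]
  refine Finset.sum_congr rfl fun k hk => ?_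
  have hk : k ≤ n := by simpa [Nat.lt_succ_iff] using hk
  have h4 : ((k + 1).factorial : ℂ) ≠ 0 := by exact_mod_cast (k + 1).factorial_ne_zero
  have h5 : ((n - k).factorial : ℂ) ≠ 0 := by exact_mod_cast (n - k).factorial_ne_zero
  have h6 := Nat.choose_mul_factorial_mul_factorial (n := n + 1) (k := k + 1) (by omega)
  rw [Nat.add_sub_add_right] at h6 ⊢
  have h7 : ((n + 1).choose (k + 1) : ℂ) * ((k + 1).factorial * (n - k).factorial)
      = (n + 1).factorial := by
    rw [← mul_assoc]; exact_mod_cast h6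
  rw [← h7]
  push_cast
  field_simp

lemma exp_one_mul_small {r : ℝ} (h : r ≤ 1 / 8) :
    Real.exp 1 * (r * Real.exp r) < 1 := by
  have h1 : Real.exp r ≤ Real.exp 1 := Real.exp_le_exp.2 (by linarith)
  have h2 := Real.exp_one_lt_d9
  have h3 := Real.exp_pos 1
  calc Real.exp 1 * (r * Real.exp r) ≤ Real.exp 1 * (1 / 8 * Real.exp 1) := by gcongr
    _ < 1 := by nlinarith

lemma norm_mul_exp_neg_lt {w : ℂ} (hw : ‖w‖ ≤ 1 / 8) :
    ‖w * Complex.exp (-w)‖ < Real.exp (-1) := by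
  have h1 : ‖Complex.exp (-w)‖ ≤ Real.exp ‖w‖ := by
    simpa using Complex.norm_exp_le_exp_norm (-w)
  have h2 := exp_one_mul_small hw
  rw [norm_mul, Real.exp_neg]
  rw [← one_div, lt_div_iff₀' (Real.exp_pos 1)]
  exact lt_of_le_of_lt (by gcongr) h2

/-- The double series that arises from `T_1 (w * exp (-w))` by expanding every factor
`exp (-(k + 1) * w)`. -/
noncomputable def expandedSummand (w : ℂ) (p : ℕ × ℕ) : ℂ :=
  ((p.1 + 1 : ℕ) : ℂ) ^ p.1 * w ^ (p.1 + 1) / ((p.1 + 1).factorial : ℂ)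
    * ((-((p.1 + 1 : ℕ) : ℂ) * w) ^ p.2 / (p.2.factorial : ℂ))

lemma summable_expandedSummand {w : ℂ} (hw : ‖w‖ ≤ 1 / 8) : Summable (expandedSummand w) := by
  have hnorm : ∀ k j : ℕ, ‖expandedSummand w (k, j)‖ = ((k + 1 : ℕ) : ℝ) ^ k * ‖w‖ ^ (k + 1) /
      ((k + 1).factorial : ℝ) * ((((k + 1 : ℕ) : ℝ) * ‖w‖) ^ j / (j.factorial : ℝ)) := by
    intro k j
    simp only [expandedSummand, norm_mul, norm_div, norm_pow, norm_neg, Complex.norm_natCast]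
  have hexpR : ∀ x : ℝ, HasSum (fun j : ℕ => x ^ j / (j.factorial : ℝ)) (Real.exp x) := by
    intro x; rw [Real.exp_eq_exp_ℝ]; exact NormedSpace.expSeries_div_hasSum_exp x
  refine Summable.of_norm ?_
  rw [summable_prod_of_nonneg (fun _ => norm_nonneg _)]
  simp only [hnorm]
  refine ⟨fun k => (hexpR _).summable.mul_left _, ?_⟩
  simp_rw [fun k : ℕ => ((hexpR (((k + 1 : ℕ) : ℝ) * ‖w‖)).mul_left (((k + 1 : ℕ) : ℝ) ^ k *
    ‖w‖ ^ (k + 1) / ((k + 1).factorial : ℝ))).tsum_eq]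
  refine Summable.of_nonneg_of_le (fun k => by positivity) (fun k => ?_)
    (summable_geometric_succ (by positivity) (exp_one_mul_small hw))
  have h := summand_norm_le (α := 1) (by norm_num) k w
  have e1 : (((k + 1 : ℕ) : ℤ) - 1) = (k : ℕ) := by push_cast; ring
  rw [e1, zpow_natCast, norm_div, norm_mul, norm_pow, norm_pow, Complex.norm_natCast,
    Complex.norm_natCast] at h
  rw [← mul_assoc, mul_pow _ (Real.exp ‖w‖), ← Real.exp_nat_mul]
  gcongr

lemma sum_antidiagonal_expandedSummand (w : ℂ) (n : ℕ) :
    ∑ p ∈ Finset.HasAntidiagonal.antidiagonal n, expandedSummand w p = if n = 0 then w else 0 := by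
  have h5 : ∑ p ∈ Finset.HasAntidiagonal.antidiagonal n, expandedSummand w p =
      w ^ (n + 1) * (if n = 0 then 1 else 0) := by
    rw [← sum_antidiagonal_pow_eq, Finset.mul_sum]
    refine Finset.sum_congr rfl fun p hp => ?_
    obtain rfl := Finset.HasAntidiagonal.mem_antidiagonal.1 hp
    have h1 : ((p.1 + 1).factorial : ℂ) ≠ 0 := by exact_mod_cast (p.1 + 1).factorial_ne_zero
    have h2 : (p.2.factorial : ℂ) ≠ 0 := by exact_mod_cast p.2.factorial_ne_zero
    rw [expandedSummand, neg_mul, neg_pow, mul_pow]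
    field_simp
    ring
  rw [h5]
  split_ifs with h <;> simp [h]

lemma hasSum_expandedSummand {w : ℂ} (hw : ‖w‖ ≤ 1 / 8) : HasSum (expandedSummand w) w := by
  have hsum := summable_expandedSummand hw
  have h1 := Finset.HasAntidiagonal.sigmaAntidiagonalEquivProd.hasSum_iff.2 hsum.hasSum
  have h2 := h1.sigma (fun n => hasSum_fintype _)
  have h3 : ∀ n : ℕ, ∑ c : Finset.HasAntidiagonal.antidiagonal n,
      (expandedSummand w ∘ Finset.HasAntidiagonal.sigmaAntidiagonalEquivProd) ⟨n, c⟩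
        = if n = 0 then w else 0 := fun n =>
    (Finset.sum_coe_sort (Finset.HasAntidiagonal.antidiagonal n) (expandedSummand w)).trans
      (sum_antidiagonal_expandedSummand w n)
  simp only [h3] at h2
  have h4 := h2.unique (hasSum_ite_eq 0 w)
  have h5 := hsum.hasSum
  rwa [h4] at h5

lemma hasSum_treeFun_mul_exp_neg {w : ℂ} (hw : ‖w‖ ≤ 1 / 8) :
    HasSum (fun k : ℕ => ((k + 1 : ℕ) : ℂ) ^ k * w ^ (k + 1) / ((k + 1).factorial : ℂ)
      * Complex.exp (-((k + 1 : ℕ) : ℂ) * w)) w := by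
  refine (hasSum_expandedSummand hw).prod_fiberwise (fun k => ?_)
  have h := NormedSpace.expSeries_div_hasSum_exp (-((k + 1 : ℕ) : ℂ) * w)
  rw [← Complex.exp_eq_exp_ℂ] at h
  simp only [expandedSummand]
  exact h.mul_left _

/-- Near `0` the tree function inverts `w ↦ w * exp (-w)`. -/
lemma treeFun_one_mul_exp_neg {w : ℂ} (hw : ‖w‖ ≤ 1 / 8) :
    treeFun 1 (w * Complex.exp (-w)) = w := by
  refine Eq.trans ?_ (hasSum_treeFun_mul_exp_neg hw).tsum_eq
  rw [treeFun]
  refine tsum_congr fun k => ?_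
  have e1 : (((k + 1 : ℕ) : ℤ) - 1) = (k : ℕ) := by push_cast; ring
  rw [e1, zpow_natCast, mul_pow, ← Complex.exp_nat_mul, mul_neg, neg_mul, ← mul_assoc,
    mul_div_right_comm]

/-! ### Differential equations on the disc of convergence -/

/-- The open disc on which the series `T_α` converge. -/
abbrev treeDisc : Set ℂ := Metric.ball 0 (Real.exp (-1))

lemma summable_bound {r : ℝ} (h0 : 0 ≤ r) (hr : r < Real.exp (-1)) :
    Summable fun k : ℕ => (Real.exp 1 * r) ^ (k + 1) := by
  refine summable_geometric_succ (by positivity) ?_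
  calc Real.exp 1 * r < Real.exp 1 * Real.exp (-1) := by gcongr
    _ = 1 := by rw [← Real.exp_add]; simp

lemma summand_norm_le_of_mem_ball {α : ℤ} (hα : 0 ≤ α) {r : ℝ} (k : ℕ) (z : ℂ)
    (hz : z ∈ Metric.ball (0 : ℂ) r) :
    ‖((k + 1 : ℕ) : ℂ) ^ (((k + 1 : ℕ) : ℤ) - α) * z ^ (k + 1) / (Nat.factorial (k + 1) : ℂ)‖
      ≤ (Real.exp 1 * r) ^ (k + 1) := by
  refine (summand_norm_le hα k z).trans ?_
  have := (mem_ball_zero_iff.1 hz).le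
  gcongr

lemma exists_radius {z : ℂ} (hz : z ∈ treeDisc) :
    ∃ r, 0 ≤ r ∧ r < Real.exp (-1) ∧ z ∈ Metric.ball (0 : ℂ) r := by
  obtain ⟨r, h1, h2⟩ := exists_between (mem_ball_zero_iff.1 hz)
  exact ⟨r, (norm_nonneg z).trans h1.le, h2, mem_ball_zero_iff.2 h1⟩

lemma differentiableOn_treeFun {α : ℤ} (hα : 0 ≤ α) :
    DifferentiableOn ℂ (treeFun α) treeDisc := by
  intro z hz
  obtain ⟨r, h0, hr, hzr⟩ := exists_radius hz
  refine DifferentiableAt.differentiableWithinAt ?_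
  refine DifferentiableOn.differentiableAt ?_ (Metric.isOpen_ball.mem_nhds hzr)
  exact Complex.differentiableOn_tsum_of_summable_norm (summable_bound h0 hr)
    (fun k => by fun_prop) Metric.isOpen_ball
    (fun k w hw => summand_norm_le_of_mem_ball hα k w hw)

lemma analyticOnNhd_treeFun {α : ℤ} (hα : 0 ≤ α) : AnalyticOnNhd ℂ (treeFun α) treeDisc :=
  (differentiableOn_treeFun hα).analyticOnNhd Metric.isOpen_ball

lemma mul_deriv_treeFun_two {z : ℂ} (hz : z ∈ treeDisc) :
    z * deriv (treeFun 2) z = treeFun 1 z := by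
  obtain ⟨r, h0, hr, hzr⟩ := exists_radius hz
  have h := Complex.hasSum_deriv_of_summable_norm (summable_bound h0 hr)
    (F := fun (k : ℕ) (w : ℂ) => ((k + 1 : ℕ) : ℂ) ^ (((k + 1 : ℕ) : ℤ) - 2) * w ^ (k + 1) /
      (Nat.factorial (k + 1) : ℂ))
    (fun k => by fun_prop) Metric.isOpen_ball
    (fun k w hw => summand_norm_le_of_mem_ball (by norm_num) k w hw) hzr
  have h2 := (h.mul_left z).tsum_eq
  change _ = z * deriv (treeFun 2) z at h2
  rw [← h2, treeFun]
  refine tsum_congr fun k => ?_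
  have h3 : ((k + 1 : ℕ) : ℂ) ≠ 0 := by exact_mod_cast Nat.succ_ne_zero k
  have h4 : (((k + 1 : ℕ) : ℤ) - 1) = (((k + 1 : ℕ) : ℤ) - 2) + 1 := by ring
  rw [h4, zpow_add_one₀ h3, deriv_div_const, deriv_const_mul_field, deriv_pow_field,
    Nat.add_sub_cancel, pow_succ]
  ring

/-- The points `w * exp (-w)` with small `w ≠ 0` accumulate at `0`, so an identity between analytic
functions that holds at all of them holds on the whole disc. -/
lemma eqOn_treeDisc_of_eventually {f g : ℂ → ℂ} (hf : AnalyticOnNhd ℂ f treeDisc)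
    (hg : AnalyticOnNhd ℂ g treeDisc)
    (h : ∀ w : ℂ, w ≠ 0 → ‖w‖ < 1 / 8 → f (w * Complex.exp (-w)) = g (w * Complex.exp (-w))) :
    Set.EqOn f g treeDisc := by
  refine hf.eqOn_of_preconnected_of_frequently_eq hg (convex_ball _ _).isPreconnected
    (z₀ := 0) (Metric.mem_ball_self (Real.exp_pos _)) ?_
  have ht : Filter.Tendsto (fun w : ℂ => w * Complex.exp (-w)) (nhdsWithin 0 {0}ᶜ)
      (nhdsWithin 0 {0}ᶜ) := by
    refine tendsto_nhdsWithin_iff.2 ⟨?_, ?_⟩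
    · have hc : Continuous fun w : ℂ => w * Complex.exp (-w) := by fun_prop
      have := hc.tendsto 0
      rw [zero_mul] at this
      exact this.mono_left nhdsWithin_le_nhds
    · filter_upwards [self_mem_nhdsWithin] with w hw
      exact mul_ne_zero hw (Complex.exp_ne_zero _)
  refine ht.frequently (Filter.Eventually.frequently ?_)
  filter_upwards [self_mem_nhdsWithin, nhdsWithin_le_nhds
    (Metric.ball_mem_nhds (0 : ℂ) (show (0 : ℝ) < 1 / 8 by norm_num))] with w hw hw'
  exact h w hw (mem_ball_zero_iff.1 hw')

lemma analyticOnNhd_exp_treeFun :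
    AnalyticOnNhd ℂ (fun z => Complex.exp (treeFun 1 z)) treeDisc :=
  (analyticOnNhd_treeFun (by norm_num)).cexp

lemma one_sub_treeFun_mul_deriv {z : ℂ} (hz : z ∈ treeDisc) :
    (1 - treeFun 1 z) * deriv (treeFun 1) z = Complex.exp (treeFun 1 z) := by
  have hT := analyticOnNhd_treeFun (α := 1) (by norm_num)
  refine eqOn_treeDisc_of_eventually (f := fun z => (1 - treeFun 1 z) * deriv (treeFun 1) z)
    ((analyticOnNhd_const.sub hT).mul hT.deriv) analyticOnNhd_exp_treeFun (fun w _ hw => ?_) hz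
  have hd := ((hT _ (mem_ball_zero_iff.2 (norm_mul_exp_neg_lt hw.le))).differentiableAt).hasDerivAt
  have hφ : HasDerivAt (fun w : ℂ => w * Complex.exp (-w))
      (1 * Complex.exp (-w) + w * (Complex.exp (-w) * -1)) w :=
    (hasDerivAt_id w).mul (hasDerivAt_neg w).cexp
  have hcomp := hd.comp w hφ
  have hid : HasDerivAt (treeFun 1 ∘ fun w : ℂ => w * Complex.exp (-w)) 1 w := by
    refine (hasDerivAt_id w).congr_of_eventuallyEq ?_
    filter_upwards [Metric.isOpen_ball.mem_nhds (mem_ball_zero_iff.2 hw)] with v hv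
    exact treeFun_one_mul_exp_neg (mem_ball_zero_iff.1 hv).le
  have h := hcomp.unique hid
  rw [Complex.exp_neg] at h
  simp only [treeFun_one_mul_exp_neg hw.le]
  rw [Complex.exp_neg]
  have he := Complex.exp_ne_zero w
  generalize deriv (treeFun 1) (w * (Complex.exp w)⁻¹) = d at h ⊢
  field_simp at h
  linear_combination h

lemma one_sub_treeFun_ne_zero {z : ℂ} (hz : z ∈ treeDisc) : 1 - treeFun 1 z ≠ 0 := fun h =>
  Complex.exp_ne_zero (treeFun 1 z) (by rw [← one_sub_treeFun_mul_deriv hz, h, zero_mul])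

lemma hasDerivAt_treeFun_one {z : ℂ} (hz : z ∈ treeDisc) :
    HasDerivAt (treeFun 1) (Complex.exp (treeFun 1 z) / (1 - treeFun 1 z)) z := by
  rw [← one_sub_treeFun_mul_deriv hz, mul_div_cancel_left₀ _ (one_sub_treeFun_ne_zero hz)]
  exact (analyticOnNhd_treeFun (by norm_num) z hz).differentiableAt.hasDerivAt

lemma deriv_treeFun_two {z : ℂ} (hz : z ∈ treeDisc) :
    deriv (treeFun 2) z = Complex.exp (treeFun 1 z) := by
  refine eqOn_treeDisc_of_eventually (analyticOnNhd_treeFun (by norm_num)).deriv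
    analyticOnNhd_exp_treeFun (fun w hw0 hw => ?_) hz
  have h := mul_deriv_treeFun_two (mem_ball_zero_iff.2 (norm_mul_exp_neg_lt hw.le))
  simp only [treeFun_one_mul_exp_neg hw.le] at h ⊢
  refine mul_left_cancel₀ (mul_ne_zero hw0 (Complex.exp_ne_zero (-w))) ?_
  rw [h, mul_assoc, ← Complex.exp_add, neg_add_cancel, Complex.exp_zero, mul_one]

/-! ### The polynomials -/

/-- The polynomials `G_n`, `n ≥ 1`, with index shifted by one: `gPoly m` is `G_{m+1}`. -/
noncomputable def gPoly : ℕ → ℂ[X]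
  | 0 => 1
  | m + 1 => ((m + 1 : ℕ) : ℂ[X]) * (2 + X) * gPoly m + (1 + X) ^ 2 * derivative (gPoly m)

/-- The polynomials `H_n`, `n ≥ 1`, with index shifted by one: `hPoly m` is `H_{m+1}`. -/
noncomputable def hPoly : ℕ → ℂ[X]
  | 0 => 1
  | m + 1 => (((2 * m + 1 : ℕ) : ℂ[X]) + (m : ℂ[X]) * X) * hPoly m + (1 + X) ^ 2 * derivative (hPoly m)

lemma hasDerivAt_eval_div {z : ℂ} (hz : z ∈ treeDisc) (P : ℂ[X]) :
    HasDerivAt (fun z => P.eval (treeFun 1 z / (1 - treeFun 1 z)))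
      ((derivative P).eval (treeFun 1 z / (1 - treeFun 1 z)) *
        (Complex.exp (treeFun 1 z) / (1 - treeFun 1 z) ^ 3)) z := by
  have hT := hasDerivAt_treeFun_one hz
  have h1 := one_sub_treeFun_ne_zero hz
  have hq := hT.div (hT.const_sub 1) h1
  refine ((P.hasDerivAt _).comp z hq).congr_deriv ?_
  congr 1
  field_simp
  ring

lemma deriv_exp_div_mul_eval {z : ℂ} (hz : z ∈ treeDisc) (n k : ℕ) (P : ℂ[X]) :
    deriv (fun z => Complex.exp (n * treeFun 1 z) / (1 - treeFun 1 z) ^ k *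
        P.eval (treeFun 1 z / (1 - treeFun 1 z))) z =
      Complex.exp ((n + 1 : ℕ) * treeFun 1 z) / (1 - treeFun 1 z) ^ (k + 1) *
        (((n : ℂ[X]) + (k : ℂ[X]) + (k : ℂ[X]) * X) * P + (1 + X) ^ 2 * derivative P).eval
          (treeFun 1 z / (1 - treeFun 1 z)) := by
  have hT := hasDerivAt_treeFun_one hz
  have h1 := one_sub_treeFun_ne_zero hz
  have hE := ((hT.const_mul (n : ℂ)).cexp.div ((hT.const_sub 1).pow k) (pow_ne_zero k h1)).mul
    (hasDerivAt_eval_div hz P)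
  refine hE.deriv.trans ?_
  simp only [eval_add, eval_mul, eval_pow, eval_one, eval_X, eval_natCast, Pi.pow_apply,
    Pi.div_apply]
  have h2 : Complex.exp ((n + 1 : ℕ) * treeFun 1 z) =
      Complex.exp (n * treeFun 1 z) * Complex.exp (treeFun 1 z) := by
    rw [← Complex.exp_add]; push_cast; ring_nf
  rw [h2]
  generalize eval (treeFun 1 z / (1 - treeFun 1 z)) P = p
  generalize eval (treeFun 1 z / (1 - treeFun 1 z)) (derivative P) = p'
  generalize Complex.exp (n * treeFun 1 z) = E
  generalize Complex.exp (treeFun 1 z) = e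
  generalize treeFun 1 z = t at h1 ⊢
  -- the derivative of the `k`-th power has the truncated exponent `k - 1`
  cases k with
  | zero =>
    field_simp
    simp
    field_simp
  | succ k =>
    simp only [Nat.add_sub_cancel, pow_succ]
    push_cast
    field_simp
    ring

lemma iteratedDeriv_succ_eq {f g : ℂ → ℂ} {n : ℕ}
    (h : ∀ z : ℂ, ‖z‖ < Real.exp (-1) → iteratedDeriv n f z = g z) {z : ℂ} (hz : z ∈ treeDisc) :
    iteratedDeriv (n + 1) f z = deriv g z := by
  rw [iteratedDeriv_succ]
  refine Filter.EventuallyEq.deriv_eq ?_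
  filter_upwards [Metric.isOpen_ball.mem_nhds hz] with w hw
  exact h w (mem_ball_zero_iff.1 hw)

lemma isGPoly_gPoly (m : ℕ) : IsGPoly (m + 1) (gPoly m) := by
  induction m with
  | zero =>
    intro z hz
    simp [gPoly, iteratedDeriv_one, (hasDerivAt_treeFun_one (mem_ball_zero_iff.2 hz)).deriv]
  | succ m ih =>
    intro z hz
    have hz := mem_ball_zero_iff.2 hz
    rw [iteratedDeriv_succ_eq ih hz, deriv_exp_div_mul_eval hz, gPoly]
    congr 3
    push_cast
    ring

lemma isHPoly_hPoly (m : ℕ) : IsHPoly (m + 1) (hPoly m) := by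
  induction m with
  | zero =>
    intro z hz
    simp [hPoly, iteratedDeriv_one, deriv_treeFun_two (mem_ball_zero_iff.2 hz)]
  | succ m ih =>
    intro z hz
    have hz := mem_ball_zero_iff.2 hz
    rw [iteratedDeriv_succ_eq ih hz, deriv_exp_div_mul_eval hz, hPoly]
    congr 3
    push_cast
    ring

/-- A polynomial is determined by its values at `T / (1 - T)`, since these include all
`w / (1 - w)` with small `w`. -/
lemma polynomial_eq_of_eval_div_eq {P Q : ℂ[X]} (h : ∀ z ∈ treeDisc,
    P.eval (treeFun 1 z / (1 - treeFun 1 z)) = Q.eval (treeFun 1 z / (1 - treeFun 1 z))) :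
    P = Q := by
  refine Polynomial.eq_of_infinite_eval_eq P Q ?_
  refine Set.infinite_of_injective_forall_mem
    (f := fun k : ℕ => ((1 / (k + 9) : ℂ)) / (1 - 1 / (k + 9))) ?_ fun k => ?_
  · intro a b hab
    have ha : (a : ℂ) + 9 ≠ 0 := by exact_mod_cast (a + 8).succ_ne_zero
    have hb : (b : ℂ) + 9 ≠ 0 := by exact_mod_cast (b + 8).succ_ne_zero
    have ha' : (a : ℂ) + 8 ≠ 0 := by exact_mod_cast (a + 7).succ_ne_zero
    have hb' : (b : ℂ) + 8 ≠ 0 := by exact_mod_cast (b + 7).succ_ne_zero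
    have e : ∀ x : ℂ, x + 9 ≠ 0 → x + 8 ≠ 0 → 1 / (x + 9) / (1 - 1 / (x + 9)) = 1 / (x + 8) := by
      intro x h1 h2
      have : 1 - 1 / (x + 9) = (x + 8) / (x + 9) := by field_simp; ring
      rw [this]
      field_simp
    simp only [e _ ha ha', e _ hb hb'] at hab
    field_simp at hab
    have h4 : (a : ℂ) = b := by linear_combination -hab
    exact_mod_cast h4
  · have hw : ‖(1 / (k + 9) : ℂ)‖ ≤ 1 / 8 := by
      have : ((k : ℂ) + 9) = ((k + 9 : ℕ) : ℂ) := by push_cast; ring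
      rw [this, norm_div, norm_one, Complex.norm_natCast]
      push_cast
      gcongr
      linarith [(Nat.cast_nonneg k : (0 : ℝ) ≤ k)]
    have := h _ (mem_ball_zero_iff.2 (norm_mul_exp_neg_lt hw))
    rwa [treeFun_one_mul_exp_neg hw] at this

lemma IsGPoly.unique {n : ℕ} {P Q : ℂ[X]} (hP : IsGPoly n P) (hQ : IsGPoly n Q) : P = Q :=
  polynomial_eq_of_eval_div_eq fun z hz => by
    have h := mem_ball_zero_iff.1 hz
    exact mul_left_cancel₀ (div_ne_zero (Complex.exp_ne_zero _)
      (pow_ne_zero _ (one_sub_treeFun_ne_zero hz))) ((hP z h).symm.trans (hQ z h))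

lemma IsHPoly.unique {n : ℕ} {P Q : ℂ[X]} (hP : IsHPoly n P) (hQ : IsHPoly n Q) : P = Q :=
  polynomial_eq_of_eval_div_eq fun z hz => by
    have h := mem_ball_zero_iff.1 hz
    exact mul_left_cancel₀ (div_ne_zero (Complex.exp_ne_zero _)
      (pow_ne_zero _ (one_sub_treeFun_ne_zero hz))) ((hP z h).symm.trans (hQ z h))

/-! ### Laminar families of label sets -/

/-- A Greg family on the labels `0, …, n - 1`: a laminar family of nonempty label sets which contains
the set of all labels and separates any two labels. These are exactly the families of sets
`{labels below v}`, `v` a vertex, of the rooted Greg trees of size `n`. -/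
structure IsGregFamily (n : ℕ) (F : Finset (Finset ℕ)) : Prop where
  nonempty : ∀ S ∈ F, S.Nonempty
  subset : ∀ S ∈ F, S ⊆ Finset.range n
  top_mem : Finset.range n ∈ F
  laminar : ∀ S ∈ F, ∀ U ∈ F, S ⊆ U ∨ U ⊆ S ∨ Disjoint S U
  separates : ∀ i < n, ∀ j < n, (∀ S ∈ F, i ∈ S ↔ j ∈ S) → i = j

/-- `S` is the least member of `F` that contains `i`; in terms of trees, `S` is the vertex that
carries the label `i`. -/
def IsOwner (F : Finset (Finset ℕ)) (i : ℕ) (S : Finset ℕ) : Prop :=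
  S ∈ F ∧ i ∈ S ∧ ∀ U ∈ F, i ∈ U → S ⊆ U

/-- The family has the label `0` at its top; in terms of trees, the root is the vertex labeled
`0`. -/
def IsZeroTop (n : ℕ) (F : Finset (Finset ℕ)) : Prop :=
  ∀ S ∈ F, 0 ∈ S → S = Finset.range n

lemma IsOwner.unique {F : Finset (Finset ℕ)} {i : ℕ} {S U : Finset ℕ} (hS : IsOwner F i S)
    (hU : IsOwner F i U) : S = U :=
  (hS.2.2 U hU.1 hU.2.1).antisymm (hU.2.2 S hS.1 hS.2.1)

namespace IsGregFamily

variable {n : ℕ} {F : Finset (Finset ℕ)}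

lemma subset_or_subset (hF : IsGregFamily n F) {S U : Finset ℕ} (hS : S ∈ F) (hU : U ∈ F) {x : ℕ}
    (hxS : x ∈ S) (hxU : x ∈ U) : S ⊆ U ∨ U ⊆ S := by
  rcases hF.laminar S hS U hU with h | h | h
  · exact Or.inl h
  · exact Or.inr h
  · exact absurd hxU (Finset.disjoint_left.1 h hxS)

/-- Members of a laminar family with a common element form a chain, so among those of them with a
given property there is a least one. -/
lemma exists_least (hF : IsGregFamily n F) (q : Finset ℕ → Prop) {x : ℕ}
    (hq : ∀ S ∈ F, q S → x ∈ S) (hex : ∃ S ∈ F, q S) :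
    ∃ S ∈ F, q S ∧ ∀ U ∈ F, q U → S ⊆ U := by
  classical
  obtain ⟨S₀, h₀, hq₀⟩ := hex
  obtain ⟨S, hS, hmin⟩ := Finset.exists_min_image (F.filter q) Finset.card
    ⟨S₀, Finset.mem_filter.2 ⟨h₀, hq₀⟩⟩
  obtain ⟨hS, hqS⟩ := Finset.mem_filter.1 hS
  refine ⟨S, hS, hqS, fun U hU hqU => ?_⟩
  rcases hF.subset_or_subset hS hU (hq S hS hqS) (hq U hU hqU) with h | h
  · exact h
  · exact (Finset.eq_of_subset_of_card_le h (hmin U (Finset.mem_filter.2 ⟨hU, hqU⟩))).ge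

lemma exists_greatest (hF : IsGregFamily n F) (q : Finset ℕ → Prop) {x : ℕ}
    (hq : ∀ S ∈ F, q S → x ∈ S) (hex : ∃ S ∈ F, q S) :
    ∃ S ∈ F, q S ∧ ∀ U ∈ F, q U → U ⊆ S := by
  classical
  obtain ⟨S₀, h₀, hq₀⟩ := hex
  obtain ⟨S, hS, hmax⟩ := Finset.exists_max_image (F.filter q) Finset.card
    ⟨S₀, Finset.mem_filter.2 ⟨h₀, hq₀⟩⟩
  obtain ⟨hS, hqS⟩ := Finset.mem_filter.1 hS
  refine ⟨S, hS, hqS, fun U hU hqU => ?_⟩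
  rcases hF.subset_or_subset hS hU (hq S hS hqS) (hq U hU hqU) with h | h
  · exact (Finset.eq_of_subset_of_card_le h (hmax U (Finset.mem_filter.2 ⟨hU, hqU⟩))).ge
  · exact h

lemma exists_isOwner (hF : IsGregFamily n F) {i : ℕ} (hi : i < n) : ∃ S, IsOwner F i S := by
  obtain ⟨S, hS, hiS, hmin⟩ := hF.exists_least (fun S => i ∈ S) (fun _ _ h => h)
    ⟨_, hF.top_mem, Finset.mem_range.2 hi⟩
  exact ⟨S, hS, hiS, hmin⟩

lemma isOwner_lt (hF : IsGregFamily n F) {i : ℕ} {S : Finset ℕ} (h : IsOwner F i S) : i < n :=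
  Finset.mem_range.1 (hF.subset S h.1 h.2.1)

lemma isOwner_inj (hF : IsGregFamily n F) {i j : ℕ} {S : Finset ℕ} (hi : IsOwner F i S)
    (hj : IsOwner F j S) : i = j :=
  hF.separates i (hF.isOwner_lt hi) j (hF.isOwner_lt hj) fun U hU =>
    ⟨fun h => hi.2.2 U hU h hj.2.1, fun h => hj.2.2 U hU h hi.2.1⟩

lemma not_mem_of_mem (hF : IsGregFamily n F) {S : Finset ℕ} (hS : S ∈ F) : n ∉ S := fun h =>
  absurd (Finset.mem_range.1 (hF.subset S hS h)) (lt_irrefl n)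

open Classical in
lemma card_unlabeled_add (hF : IsGregFamily n F) :
    (F.filter fun S => ¬ ∃ i, IsOwner F i S).card + n = F.card := by
  have h : (F.filter fun S => ∃ i, IsOwner F i S).card = n := by
    choose! g hg using fun i hi => hF.exists_isOwner (i := i) hi
    refine Eq.trans ?_ (Finset.card_range n)
    symm
    refine Finset.card_bij (fun i _ => g i) (fun i hi => ?_) (fun i hi j hj hij => ?_)
      (fun S hS => ?_)
    · have := hg i (Finset.mem_range.1 hi)
      exact Finset.mem_filter.2 ⟨this.1, i, this⟩
    · have h1 := hg i (Finset.mem_range.1 hi)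
      have h2 := hg j (Finset.mem_range.1 hj)
      rw [← hij] at h2
      exact hF.isOwner_inj h1 h2
    · obtain ⟨_, i, hi⟩ := Finset.mem_filter.1 hS
      exact ⟨i, Finset.mem_range.2 (hF.isOwner_lt hi),
        (hg i (hF.isOwner_lt hi)).unique hi⟩
  have := Finset.card_filter_add_card_filter_not (s := F) (fun S => ∃ i, IsOwner F i S)
  omega

end IsGregFamily

/-! ### Inserting a new label -/

/-- Insertion of the label `n` at the member `S` of `F`: the members that contain `S` receive the
new label; `keep` tells whether `S` itself also stays in the family, and `leaf` whether `{n}` is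
added. In terms of trees, `n` becomes a new leaf at `S` (`leaf` alone) or at a new unlabeled vertex
just above `S` (both), or the label of a new vertex just above `S` (`keep` alone), or of
the so far unlabeled vertex `S` itself (neither). -/
def insertLabel (n : ℕ) (F : Finset (Finset ℕ)) (S : Finset ℕ) (keep leaf : Bool) :
    Finset (Finset ℕ) :=
  (F.filter fun U => ¬ S ⊆ U) ∪ (F.filter fun U => S ⊆ U).image (insert n) ∪
    ((if keep then {S} else ∅) ∪ (if leaf then {{n}} else ∅))

section insertLabel

variable {n : ℕ} {F : Finset (Finset ℕ)} {S : Finset ℕ} {keep leaf : Bool}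

lemma mem_insertLabel {U : Finset ℕ} : U ∈ insertLabel n F S keep leaf ↔
    (U ∈ F ∧ ¬ S ⊆ U) ∨ (∃ V ∈ F, S ⊆ V ∧ insert n V = U) ∨ (keep = true ∧ U = S) ∨
      (leaf = true ∧ U = {n}) := by
  simp only [insertLabel, Finset.mem_union, Finset.mem_filter, Finset.mem_image, and_assoc, or_assoc]
  cases keep <;> cases leaf <;> simp

lemma card_insertLabel (hF : IsGregFamily n F) (hS : S ∈ F) :
    (insertLabel n F S keep leaf).card = F.card + keep.toNat + leaf.toNat := by
  have hn := fun {U} (hU : U ∈ F) => hF.not_mem_of_mem hU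
  have hinj : ((F.filter fun U => S ⊆ U).image (insert n)).card =
      (F.filter fun U => S ⊆ U).card := by
    refine Finset.card_image_of_injOn fun U hU V hV h => ?_
    have hU := hn (Finset.mem_filter.1 hU).1
    have hV := hn (Finset.mem_filter.1 hV).1
    rw [← Finset.erase_insert hU, ← Finset.erase_insert hV]
    exact congrArg (Finset.erase · n) h
  rw [insertLabel, Finset.card_union_of_disjoint, Finset.card_union_of_disjoint,
    Finset.card_union_of_disjoint, hinj,
    ← Finset.card_filter_add_card_filter_not (s := F) (fun U => S ⊆ U)]
  · cases keep <;> cases leaf <;> simp <;> omega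
  · cases keep <;> cases leaf <;> simp
    rintro rfl
    exact hn hS (Finset.mem_singleton_self n)
  · refine Finset.disjoint_left.2 fun U h1 h2 => ?_
    obtain ⟨V, _, rfl⟩ := Finset.mem_image.1 h2
    exact hn (Finset.mem_filter.1 h1).1 (Finset.mem_insert_self n V)
  · refine Finset.disjoint_left.2 fun U h1 h2 => ?_
    have h2 : U = S ∨ U = {n} := by
      cases keep <;> cases leaf <;> simp at h2 <;> tauto
    rcases Finset.mem_union.1 h1 with h | h
    · obtain ⟨hU, hSU⟩ := Finset.mem_filter.1 h
      rcases h2 with rfl | rfl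
      · exact hSU subset_rfl
      · exact hn hU (Finset.mem_singleton_self n)
    · obtain ⟨V, hV, rfl⟩ := Finset.mem_image.1 h
      obtain ⟨hVF, hSV⟩ := Finset.mem_filter.1 hV
      rcases h2 with h2 | h2
      · exact hn hS (h2 ▸ Finset.mem_insert_self n V)
      · obtain ⟨x, hx⟩ := hF.nonempty V hVF
        have := Finset.mem_singleton.1 (h2 ▸ Finset.mem_insert_of_mem hx)
        exact hn hVF (this ▸ hx)

/-- The choice `keep = leaf = false` puts the new label on the vertex `S`, which is only
possible if `S` does not carry a label yet. -/
lemma isGregFamily_insertLabel (hF : IsGregFamily n F) (hS : S ∈ F)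
    (hv : keep = true ∨ leaf = true ∨ ¬ ∃ i, IsOwner F i S) :
    IsGregFamily (n + 1) (insertLabel n F S keep leaf) := by
  have hn := fun {U} (hU : U ∈ F) => hF.not_mem_of_mem hU
  obtain ⟨x, hx⟩ := hF.nonempty S hS
  have hlow : ∀ U ∈ insertLabel n F S keep leaf,
      (U ∈ F ∧ (S ⊆ U → U = S)) ∨ (∃ V ∈ F, S ⊆ V ∧ insert n V = U) ∨ U = {n} := by
    intro U hU
    rcases mem_insertLabel.1 hU with h | h | h | h
    · exact Or.inl ⟨h.1, fun h' => absurd h' h.2⟩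
    · exact Or.inr (Or.inl h)
    · exact Or.inl ⟨h.2 ▸ hS, fun _ => h.2⟩
    · exact Or.inr (Or.inr h.2)
  have h12 : ∀ U ∈ F, (S ⊆ U → U = S) → ∀ V ∈ F, S ⊆ V →
      U ⊆ insert n V ∨ Disjoint U (insert n V) := by
    intro U hU hSU V hV hSV
    rcases hF.laminar U hU V hV with h | h | h
    · exact Or.inl (h.trans (Finset.subset_insert n V))
    · rw [hSU (hSV.trans h)]
      exact Or.inl (hSV.trans (Finset.subset_insert n V))
    · exact Or.inr (Finset.disjoint_insert_right.2 ⟨hn hU, h⟩)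
  refine ⟨fun U hU => ?_, fun U hU => ?_, ?_, fun U hU V hV => ?_, fun i hi j hj hij => ?_⟩
  · rcases hlow U hU with h | ⟨V, _, _, rfl⟩ | rfl
    · exact hF.nonempty U h.1
    · exact Finset.insert_nonempty n V
    · exact Finset.singleton_nonempty n
  · rw [Finset.range_add_one]
    rcases hlow U hU with h | ⟨V, hV, _, rfl⟩ | rfl
    · exact (hF.subset U h.1).trans (Finset.subset_insert _ _)
    · exact Finset.insert_subset_insert n (hF.subset V hV)
    · exact Finset.singleton_subset_iff.2 (Finset.mem_insert_self _ _)
  · rw [Finset.range_add_one]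
    exact mem_insertLabel.2 (Or.inr (Or.inl ⟨_, hF.top_mem, hF.subset S hS, rfl⟩))
  · rcases hlow U hU with ⟨hU', hSU⟩ | ⟨U, hU', hSU, rfl⟩ | rfl <;>
      rcases hlow V hV with ⟨hV', hSV⟩ | ⟨V, hV', hSV, rfl⟩ | rfl
    · exact hF.laminar U hU' V hV'
    · exact (h12 U hU' hSU V hV' hSV).imp_right Or.inr
    · exact Or.inr (Or.inr (Finset.disjoint_singleton_right.2 (hn hU')))
    · exact Or.inr ((h12 V hV' hSV U hU' hSU).imp_right fun h => h.symm)
    · rcases hF.subset_or_subset hU' hV' (hSU hx) (hSV hx) with h | h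
      · exact Or.inl (Finset.insert_subset_insert n h)
      · exact Or.inr (Or.inl (Finset.insert_subset_insert n h))
    · exact Or.inr (Or.inl (Finset.singleton_subset_iff.2 (Finset.mem_insert_self _ _)))
    · exact Or.inr (Or.inr (Finset.disjoint_singleton_left.2 (hn hV')))
    · exact Or.inl (Finset.singleton_subset_iff.2 (Finset.mem_insert_self _ _))
    · exact Or.inl subset_rfl
  · -- the new label `n` is separated from every old label `j`
    have hnew : ∀ j < n, (∀ U ∈ insertLabel n F S keep leaf, j ∈ U ↔ n ∈ U) → False := by
      intro j hj hjn
      have hjS : j ∈ S := by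
        have := (hjn _ (mem_insertLabel.2 (Or.inr (Or.inl ⟨S, hS, subset_rfl, rfl⟩)))).2
          (Finset.mem_insert_self n S)
        exact (Finset.mem_insert.1 this).resolve_left hj.ne
      rcases hv with h | h | h
      · exact hn hS ((hjn S (mem_insertLabel.2 (Or.inr (Or.inr (Or.inl ⟨h, rfl⟩))))).1 hjS)
      · have := (hjn {n} (mem_insertLabel.2 (Or.inr (Or.inr (Or.inr ⟨h, rfl⟩))))).2
          (Finset.mem_singleton_self n)
        exact hj.ne (Finset.mem_singleton.1 this)
      · refine h ⟨j, hS, hjS, fun U hU hjU => ?_⟩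
        by_contra hSU
        exact hn hU ((hjn U (mem_insertLabel.2 (Or.inl ⟨hU, hSU⟩))).1 hjU)
    rcases Nat.lt_succ_iff_lt_or_eq.1 hi with hi | rfl <;>
      rcases Nat.lt_succ_iff_lt_or_eq.1 hj with hj | rfl
    · refine hF.separates i hi j hj fun U hU => ?_
      by_cases hSU : S ⊆ U
      · have := hij _ (mem_insertLabel.2 (Or.inr (Or.inl ⟨U, hU, hSU, rfl⟩)))
        simpa [hi.ne, hj.ne] using this
      · exact hij U (mem_insertLabel.2 (Or.inl ⟨hU, hSU⟩))
    · exact (hnew i hi hij).elim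
    · exact (hnew j hj fun U hU => (hij U hU).symm).elim
    · rfl

lemma isZeroTop_insertLabel (hn : 1 ≤ n) (hF : IsGregFamily n F) (hS : S ∈ F) :
    IsZeroTop (n + 1) (insertLabel n F S keep leaf) ↔
      IsZeroTop n F ∧ (S = Finset.range n → keep = false) := by
  have hnm := fun {U} (hU : U ∈ F) => hF.not_mem_of_mem hU
  refine ⟨fun h => ⟨fun U hU h0 => ?_, fun hSn => ?_⟩, fun h U hU h0 => ?_⟩
  · by_cases hSU : S ⊆ U
    · have := h _ (mem_insertLabel.2 (Or.inr (Or.inl ⟨U, hU, hSU, rfl⟩)))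
        (Finset.mem_insert_of_mem h0)
      rw [Finset.range_add_one] at this
      rw [← Finset.erase_insert (hnm hU), this, Finset.erase_insert Finset.notMem_range_self]
    · have := h U (mem_insertLabel.2 (Or.inl ⟨hU, hSU⟩)) h0
      exact absurd (this ▸ Finset.self_mem_range_succ n) (hnm hU)
  · by_contra hk
    rw [Bool.not_eq_false] at hk
    have := h S (mem_insertLabel.2 (Or.inr (Or.inr (Or.inl ⟨hk, rfl⟩))))
      (hSn ▸ Finset.mem_range.2 hn)
    exact absurd (this ▸ Finset.self_mem_range_succ n) (hnm hS)
  · rcases mem_insertLabel.1 hU with hU | ⟨V, hV, _, rfl⟩ | ⟨hk, rfl⟩ | ⟨_, rfl⟩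
    · exact absurd (h.1 U hU.1 h0 ▸ hF.subset S hS) hU.2
    · have h0 : 0 ∈ V := (Finset.mem_insert.1 h0).resolve_left (by omega)
      rw [h.1 V hV h0, Finset.range_add_one]
    · exact absurd hk (by rw [h.2 (h.1 U hS h0)]; simp)
    · exact absurd (Finset.mem_singleton.1 h0) (by omega)

/-- The data of an insertion can be read off from its result. -/
lemma insertLabel_injective {F' : Finset (Finset ℕ)} {S' : Finset ℕ} {keep' leaf' : Bool}
    (hF : IsGregFamily n F) (hS : S ∈ F) (hF' : IsGregFamily n F') (hS' : S' ∈ F')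
    (h : insertLabel n F S keep leaf = insertLabel n F' S' keep' leaf') :
    F = F' ∧ S = S' ∧ keep = keep' ∧ leaf = leaf' := by
  have key : ∀ {F F' : Finset (Finset ℕ)} {S S' : Finset ℕ} {keep leaf keep' leaf' : Bool},
      IsGregFamily n F → S ∈ F → IsGregFamily n F' → S' ∈ F' →
      insertLabel n F S keep leaf = insertLabel n F' S' keep' leaf' →
      F ⊆ F' ∧ S' ⊆ S ∧ (S = S' → keep = true → keep' = true) ∧ (leaf = true → leaf' = true) := by
    intro F F' S S' keep leaf keep' leaf' hF hS hF' hS' h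
    have hn := fun {U} (hU : U ∈ F) => hF.not_mem_of_mem hU
    have hn' := fun {U} (hU : U ∈ F') => hF'.not_mem_of_mem hU
    have hins : ∀ V ∈ F, insert n V ∈ insertLabel n F' S' keep' leaf' → V ∈ F' ∧ S' ⊆ V := by
      intro V hV hV'
      rcases mem_insertLabel.1 hV' with h1 | ⟨W, hW, hSW, h1⟩ | h1 | h1
      · exact absurd (Finset.mem_insert_self n V) (hn' h1.1)
      · rw [← Finset.erase_insert (hn hV), ← h1, Finset.erase_insert (hn' hW)]
        exact ⟨hW, hSW⟩
      · exact absurd (h1.2 ▸ Finset.mem_insert_self n V) (hn' hS')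
      · obtain ⟨x, hx⟩ := hF.nonempty V hV
        have := Finset.mem_singleton.1 (h1.2 ▸ Finset.mem_insert_of_mem hx)
        exact absurd (this ▸ hx) (hn hV)
    refine ⟨fun U hU => ?_, ?_, ?_, ?_⟩
    · by_cases hSU : S ⊆ U
      · refine (hins U hU ?_).1
        rw [← h]
        exact mem_insertLabel.2 (Or.inr (Or.inl ⟨U, hU, hSU, rfl⟩))
      · have hU' : U ∈ insertLabel n F' S' keep' leaf' := by
          rw [← h]
          exact mem_insertLabel.2 (Or.inl ⟨hU, hSU⟩)
        rcases mem_insertLabel.1 hU' with h1 | ⟨W, hW, hSW, h1⟩ | h1 | h1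
        · exact h1.1
        · exact absurd (h1 ▸ Finset.mem_insert_self n W) (hn hU)
        · exact h1.2 ▸ hS'
        · exact absurd (h1.2 ▸ Finset.mem_singleton_self n) (hn hU)
    · refine (hins S hS ?_).2
      rw [← h]
      exact mem_insertLabel.2 (Or.inr (Or.inl ⟨S, hS, subset_rfl, rfl⟩))
    · rintro rfl hk
      have hU' : S ∈ insertLabel n F' S keep' leaf' := by
        rw [← h]
        exact mem_insertLabel.2 (Or.inr (Or.inr (Or.inl ⟨hk, rfl⟩)))
      rcases mem_insertLabel.1 hU' with h1 | ⟨W, hW, hSW, h1⟩ | h1 | h1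
      · exact absurd subset_rfl h1.2
      · exact absurd (h1 ▸ Finset.mem_insert_self n W) (hn hS)
      · exact h1.1
      · exact absurd (h1.2 ▸ Finset.mem_singleton_self n) (hn hS)
    · intro hl
      have hU' : {n} ∈ insertLabel n F' S' keep' leaf' := by
        rw [← h]
        exact mem_insertLabel.2 (Or.inr (Or.inr (Or.inr ⟨hl, rfl⟩)))
      rcases mem_insertLabel.1 hU' with h1 | ⟨W, hW, hSW, h1⟩ | h1 | h1
      · exact absurd (Finset.mem_singleton_self n) (hn' h1.1)
      · obtain ⟨x, hx⟩ := hF'.nonempty W hW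
        have := Finset.mem_singleton.1 (h1 ▸ Finset.mem_insert_of_mem hx)
        exact absurd (this ▸ hx) (hn' hW)
      · exact absurd (h1.2 ▸ Finset.mem_singleton_self n) (hn' hS')
      · exact h1.1
  obtain ⟨a1, b1, c1, d1⟩ := key hF hS hF' hS' h
  obtain ⟨a2, b2, c2, d2⟩ := key hF' hS' hF hS h.symm
  have hSS := b2.antisymm b1
  exact ⟨a1.antisymm a2, hSS, Bool.eq_iff_iff.2 ⟨c1 hSS, c2 hSS.symm⟩, Bool.eq_iff_iff.2 ⟨d1, d2⟩⟩

end insertLabel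

/-- Deletion of the label `n` from a family. -/
def deleteLabel (n : ℕ) (F : Finset (Finset ℕ)) : Finset (Finset ℕ) :=
  (F.image (Finset.erase · n)).erase ∅

lemma mem_deleteLabel {n : ℕ} {F : Finset (Finset ℕ)} {V : Finset ℕ} :
    V ∈ deleteLabel n F ↔ V.Nonempty ∧ ∃ U ∈ F, U.erase n = V := by
  simp [deleteLabel, Finset.nonempty_iff_ne_empty]

lemma isGregFamily_deleteLabel {n : ℕ} (hn : 1 ≤ n) {F : Finset (Finset ℕ)}
    (hF : IsGregFamily (n + 1) F) : IsGregFamily n (deleteLabel n F) := by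
  refine ⟨fun S hS => (mem_deleteLabel.1 hS).1, fun S hS => ?_, ?_, fun S hS U hU => ?_,
    fun i hi j hj hij => ?_⟩
  · obtain ⟨_, U, hU, rfl⟩ := mem_deleteLabel.1 hS
    have := Finset.erase_subset_erase n (hF.subset U hU)
    rwa [Finset.range_add_one, Finset.erase_insert Finset.notMem_range_self] at this
  · refine mem_deleteLabel.2 ⟨⟨0, Finset.mem_range.2 hn⟩, _, hF.top_mem, ?_⟩
    rw [Finset.range_add_one, Finset.erase_insert Finset.notMem_range_self]
  · obtain ⟨_, S, hS', rfl⟩ := mem_deleteLabel.1 hS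
    obtain ⟨_, U, hU', rfl⟩ := mem_deleteLabel.1 hU
    rcases hF.laminar S hS' U hU' with h | h | h
    · exact Or.inl (Finset.erase_subset_erase n h)
    · exact Or.inr (Or.inl (Finset.erase_subset_erase n h))
    · exact Or.inr (Or.inr (h.mono (Finset.erase_subset _ _) (Finset.erase_subset _ _)))
  · refine hF.separates i (by omega) j (by omega) fun U hU => ?_
    by_cases hne : (U.erase n).Nonempty
    · have := hij _ (mem_deleteLabel.2 ⟨hne, U, hU, rfl⟩)
      simpa [Finset.mem_erase, hi.ne, hj.ne] using this
    · have h : ∀ k < n, k ∉ U := fun k hk hkU =>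
        hne ⟨k, Finset.mem_erase.2 ⟨hk.ne, hkU⟩⟩
      simp [h i hi, h j hj]

/-- Every family arises by inserting its last label into the family without that label. -/
lemma exists_eq_insertLabel {n : ℕ} (hn : 1 ≤ n) {F : Finset (Finset ℕ)}
    (hF : IsGregFamily (n + 1) F) :
    ∃ S ∈ deleteLabel n F, ∃ keep leaf : Bool,
      (keep = true ∨ leaf = true ∨ ¬ ∃ i, IsOwner (deleteLabel n F) i S) ∧
      insertLabel n (deleteLabel n F) S keep leaf = F := by
  classical
  have hD := isGregFamily_deleteLabel hn hF
  obtain ⟨P, hP, ⟨hnP, hPn⟩, hmin⟩ := hF.exists_least (fun U => n ∈ U ∧ U ≠ {n}) (x := n)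
    (fun _ _ h => h.1) ⟨_, hF.top_mem, Finset.self_mem_range_succ n, fun h => by
      have : 0 ∈ Finset.range (n + 1) := Finset.mem_range.2 (by omega)
      rw [h, Finset.mem_singleton] at this
      omega⟩
  have hnon : ∀ {U : Finset ℕ}, n ∈ U → U ≠ {n} → (U.erase n).Nonempty := by
    intro U h1 h2
    rw [Finset.nonempty_iff_ne_empty]
    intro h
    rw [Finset.erase_eq_empty_iff] at h
    rcases h with h | h
    · simp [h] at h1
    · exact h2 h
  obtain ⟨S, rfl⟩ : ∃ S, S = P.erase n := ⟨_, rfl⟩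
  have hSne := hnon hnP hPn
  have hSP : insert n (P.erase n) = P := Finset.insert_erase hnP
  have hS : P.erase n ∈ deleteLabel n F := mem_deleteLabel.2 ⟨hSne, P, hP, rfl⟩
  -- a member without `n` that contains `P.erase n` must be equal to it
  have hlow : ∀ U ∈ F, n ∉ U → P.erase n ⊆ U → U = P.erase n := by
    intro U hU hnU hSU
    rcases hF.laminar P hP U hU with h | h | h
    · exact absurd (h hnP) hnU
    · refine Finset.Subset.antisymm (fun x hx => ?_) hSU
      exact Finset.mem_erase.2 ⟨fun hxn => hnU (hxn ▸ hx), h hx⟩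
    · obtain ⟨x, hx⟩ := hSne
      exact absurd (hSU hx) (Finset.disjoint_left.1 h (Finset.mem_of_mem_erase hx))
  have herase : ∀ U ∈ F, n ∉ U → U ∈ deleteLabel n F := fun U hU hnU =>
    mem_deleteLabel.2 ⟨hF.nonempty U hU, U, hU, Finset.erase_eq_of_notMem hnU⟩
  refine ⟨P.erase n, hS, decide (P.erase n ∈ F), decide ({n} ∈ F), ?_, ?_⟩
  · by_contra! hcon
    obtain ⟨h1, h2, i, hi⟩ := hcon
    rw [Ne, decide_eq_true_eq] at h1 h2
    have hin := hD.isOwner_lt hi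
    refine hin.ne (hF.separates i (by omega) n (by omega) fun U hU => ⟨fun hiU => ?_, fun hnU => ?_⟩)
    · by_contra hnU
      exact h1 (hlow U hU hnU (hi.2.2 U (herase U hU hnU) hiU) ▸ hU)
    · exact hmin U hU ⟨hnU, fun h => h2 (h ▸ hU)⟩ (Finset.mem_of_mem_erase hi.2.1)
  · ext U
    rw [mem_insertLabel, decide_eq_true_eq, decide_eq_true_eq]
    constructor
    · rintro (⟨hU, hSU⟩ | ⟨V, hV, hSV, rfl⟩ | ⟨h, rfl⟩ | ⟨h, rfl⟩)
      · obtain ⟨hne, W, hW, rfl⟩ := mem_deleteLabel.1 hU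
        by_cases hnW : n ∈ W
        · refine absurd (Finset.erase_subset_erase n (hmin W hW ⟨hnW, ?_⟩)) hSU
          rintro rfl
          simp at hne
        · rwa [Finset.erase_eq_of_notMem hnW]
      · obtain ⟨hne, W, hW, rfl⟩ := mem_deleteLabel.1 hV
        by_cases hnW : n ∈ W
        · rwa [Finset.insert_erase hnW]
        · rw [Finset.erase_eq_of_notMem hnW] at hSV ⊢
          rwa [hlow W hW hnW hSV, hSP]
      · exact h
      · exact h
    · intro hU
      by_cases hnU : n ∈ U
      · by_cases hUn : U = {n}
        · exact Or.inr (Or.inr (Or.inr ⟨hUn ▸ hU, hUn⟩))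
        · exact Or.inr (Or.inl ⟨U.erase n, mem_deleteLabel.2 ⟨hnon hnU hUn, U, hU, rfl⟩,
            Finset.erase_subset_erase n (hmin U hU ⟨hnU, hUn⟩), Finset.insert_erase hnU⟩)
      · by_cases hSU : P.erase n ⊆ U
        · have := hlow U hU hnU hSU
          exact Or.inr (Or.inr (Or.inl ⟨this ▸ hU, this⟩))
        · exact Or.inl ⟨herase U hU hnU, hSU⟩

/-! ### Generating polynomials of the families -/

open Classical in
/-- The finite set of all Greg families on `n` labels. -/
noncomputable def gregFamilies (n : ℕ) : Finset (Finset (Finset ℕ)) :=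
  (Finset.range n).powerset.powerset.filter (IsGregFamily n)

lemma mem_gregFamilies {n : ℕ} {F : Finset (Finset ℕ)} :
    F ∈ gregFamilies n ↔ IsGregFamily n F := by
  simp only [gregFamilies, Finset.mem_filter, Finset.mem_powerset, and_iff_right_iff_imp]
  exact fun h S hS => Finset.mem_powerset.2 (h.subset S hS)

open Classical in
/-- The pairs `(keep, leaf)` with which a new label can be inserted at `S`. -/
noncomputable def insertOptions (F : Finset (Finset ℕ)) (S : Finset ℕ) : Finset (Bool × Bool) :=
  Finset.univ.filter fun b => b.1 = true ∨ b.2 = true ∨ ¬ ∃ i, IsOwner F i S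

lemma sum_gregFamilies_succ {n : ℕ} (hn : 1 ≤ n) (f : Finset (Finset ℕ) → ℂ[X]) :
    ∑ F ∈ gregFamilies (n + 1), f F = ∑ F ∈ gregFamilies n, ∑ S ∈ F, ∑ b ∈ insertOptions F S,
      f (insertLabel n F S b.1 b.2) := by
  have h : ∀ F ∈ gregFamilies n, ∑ S ∈ F, ∑ b ∈ insertOptions F S,
      f (insertLabel n F S b.1 b.2) = ∑ p ∈ F.sigma (fun S => insertOptions F S),
        f (insertLabel n F p.1 p.2.1 p.2.2) := fun F _ => by
    rw [Finset.sum_sigma]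
  rw [Finset.sum_congr rfl h, Finset.sum_sigma']
  symm
  refine Finset.sum_bij (fun a _ => insertLabel n a.1 a.2.1 a.2.2.1 a.2.2.2) ?_ ?_ ?_ ?_
  · rintro ⟨F, S, keep, leaf⟩ ha
    simp only [Finset.mem_sigma, mem_gregFamilies, insertOptions, Finset.mem_filter,
      Finset.mem_univ, true_and] at ha ⊢
    exact isGregFamily_insertLabel ha.1 ha.2.1 ha.2.2
  · rintro ⟨F, S, keep, leaf⟩ ha ⟨F', S', keep', leaf'⟩ ha' h
    simp only [Finset.mem_sigma, mem_gregFamilies] at ha ha'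
    obtain ⟨rfl, rfl, rfl, rfl⟩ := insertLabel_injective ha.1 ha.2.1 ha'.1 ha'.2.1 h
    rfl
  · intro F hF
    obtain ⟨S, hS, keep, leaf, hv, h⟩ := exists_eq_insertLabel hn (mem_gregFamilies.1 hF)
    refine ⟨⟨deleteLabel n F, S, keep, leaf⟩, ?_, h⟩
    simp only [Finset.mem_sigma, mem_gregFamilies, insertOptions, Finset.mem_filter,
      Finset.mem_univ, true_and]
    exact ⟨isGregFamily_deleteLabel hn (mem_gregFamilies.1 hF), hS, hv⟩
  · intro a _
    rfl

open Classical in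
lemma sum_insertOptions (F : Finset (Finset ℕ)) (S : Finset ℕ) (g : Bool × Bool → ℂ[X]) :
    ∑ b ∈ insertOptions F S, g b = g (true, false) + g (false, true) + g (true, true) +
      if ∃ i, IsOwner F i S then 0 else g (false, false) := by
  rw [insertOptions, Finset.sum_filter, Fintype.sum_prod_type]
  simp only [Fintype.sum_bool]
  generalize (∃ i, IsOwner F i S) = p
  by_cases h : p <;> simp [h] <;> ring

open Classical in
lemma sum_insertOptions_pow {n : ℕ} {F : Finset (Finset ℕ)} {S : Finset ℕ}
    (hF : IsGregFamily n F) (hS : S ∈ F) :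
    ∑ b ∈ insertOptions F S, (X : ℂ[X]) ^ ((insertLabel n F S b.1 b.2).card - (n + 1)) =
      (2 * X ^ (F.card - n) + X ^ (F.card - n + 1)) +
        if ¬ ∃ i, IsOwner F i S then X ^ (F.card - n - 1) else 0 := by
  have hc := hF.card_unlabeled_add
  have e1 : F.card + 1 + 0 - (n + 1) = F.card - n := by omega
  have e3 : F.card + 1 + 1 - (n + 1) = F.card - n + 1 := by omega
  have e4 : F.card + 0 + 0 - (n + 1) = F.card - n - 1 := by omega
  rw [sum_insertOptions]
  simp only [card_insertLabel hF hS, Bool.toNat_true, Bool.toNat_false, e1, e3, e4, ite_not]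
  ring

lemma sum_sum_insertOptions_pow {n : ℕ} {F : Finset (Finset ℕ)} (hF : IsGregFamily n F) :
    ∑ S ∈ F, ∑ b ∈ insertOptions F S,
        (X : ℂ[X]) ^ ((insertLabel n F S b.1 b.2).card - (n + 1)) =
      (n : ℂ[X]) * (2 + X) * X ^ (F.card - n) +
        (1 + X) ^ 2 * derivative (X ^ (F.card - n)) := by
  classical
  rw [Finset.sum_congr rfl fun S hS => sum_insertOptions_pow hF hS, Finset.sum_add_distrib,
    Finset.sum_const, ← Finset.sum_filter, Finset.sum_const, derivative_X_pow]
  have hc := hF.card_unlabeled_add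
  generalize (F.filter fun S => ¬ ∃ i, IsOwner F i S).card = k at hc ⊢
  rw [← hc, Nat.add_sub_cancel]
  -- for `k = 0` the truncated exponent `k - 1` only occurs with the coefficient `0`
  cases k with
  | zero => simp; ring
  | succ k =>
    simp only [nsmul_eq_mul, Nat.add_sub_cancel, map_natCast]
    push_cast
    ring

lemma gregFamilies_one : gregFamilies 1 = {{{0}}} := by
  have h1 : Finset.range 1 = {0} := rfl
  ext F
  rw [mem_gregFamilies, Finset.mem_singleton]
  refine ⟨fun h => ?_, ?_⟩
  · ext S
    rw [Finset.mem_singleton]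
    refine ⟨fun hS => ?_, ?_⟩
    · exact ((Finset.Nonempty.subset_singleton_iff (h.nonempty S hS)).1 (h.subset S hS))
    · rintro rfl
      exact h.top_mem
  · rintro rfl
    refine ⟨?_, ?_, ?_, ?_, fun i hi j hj _ => by omega⟩ <;> simp [h1]

/-- The recurrence for the generating polynomials of the families, obtained by inserting the last
label, is that of the polynomials `G_n`. -/
lemma sum_gregFamilies (m : ℕ) :
    ∑ F ∈ gregFamilies (m + 1), (X : ℂ[X]) ^ (F.card - (m + 1)) = gPoly m := by
  induction m with
  | zero => simp [gregFamilies_one, gPoly]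
  | succ m ih =>
    rw [sum_gregFamilies_succ (by omega), Finset.sum_congr rfl fun F hF =>
      sum_sum_insertOptions_pow (mem_gregFamilies.1 hF), Finset.sum_add_distrib,
      ← Finset.mul_sum, ← Finset.mul_sum, ← derivative_sum, ih, gPoly]

lemma sum_sum_insertOptions_zeroTop {n : ℕ} (hn : 1 ≤ n) {F : Finset (Finset ℕ)}
    (hF : IsGregFamily n F) (hF0 : IsZeroTop n F) [DecidablePred (IsZeroTop (n + 1))] :
    ∑ S ∈ F, ∑ b ∈ insertOptions F S, (if IsZeroTop (n + 1) (insertLabel n F S b.1 b.2) then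
        (X : ℂ[X]) ^ ((insertLabel n F S b.1 b.2).card - (n + 1)) else 0) +
          (X ^ (F.card - n) + X ^ (F.card - n + 1)) =
      (n : ℂ[X]) * (2 + X) * X ^ (F.card - n) +
        (1 + X) ^ 2 * derivative (X ^ (F.card - n)) := by
  classical
  rw [← sum_sum_insertOptions_pow hF, ← Finset.add_sum_erase F _ hF.top_mem,
    ← Finset.add_sum_erase F _ hF.top_mem]
  have h1 : ∑ S ∈ F.erase (Finset.range n), ∑ b ∈ insertOptions F S,
      (if IsZeroTop (n + 1) (insertLabel n F S b.1 b.2) then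
        (X : ℂ[X]) ^ ((insertLabel n F S b.1 b.2).card - (n + 1)) else 0) =
      ∑ S ∈ F.erase (Finset.range n), ∑ b ∈ insertOptions F S,
        (X : ℂ[X]) ^ ((insertLabel n F S b.1 b.2).card - (n + 1)) := by
    refine Finset.sum_congr rfl fun S hS => Finset.sum_congr rfl fun b _ => if_pos ?_
    obtain ⟨hSn, hS⟩ := Finset.mem_erase.1 hS
    exact (isZeroTop_insertLabel hn hF hS).2 ⟨hF0, fun h => absurd h hSn⟩
  have howner : ∃ i, IsOwner F i (Finset.range n) :=
    ⟨0, hF.top_mem, Finset.mem_range.2 hn, fun U hU h0 => (hF0 U hU h0).ge⟩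
  have e2 : F.card + 0 + 1 - (n + 1) = F.card - n := by omega
  rw [h1, sum_insertOptions_pow hF hF.top_mem, sum_insertOptions, if_pos howner,
    if_neg (not_not.2 howner)]
  simp only [isZeroTop_insertLabel hn hF hF.top_mem, hF0, card_insertLabel hF hF.top_mem,
    true_and, forall_const, if_true, Bool.true_eq_false, if_false, Bool.toNat_true,
    Bool.toNat_false, e2]
  ring

open Classical in
/-- For the families with label `0` at the top, where `keep` is not possible at the top member, the
recurrence is that of the polynomials `H_n`. -/
lemma sum_gregFamilies_zeroTop (m : ℕ) :
    ∑ F ∈ (gregFamilies (m + 1)).filter (IsZeroTop (m + 1)), (X : ℂ[X]) ^ (F.card - (m + 1)) =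
      hPoly m := by
  induction m with
  | zero =>
    have : IsZeroTop 1 {{0}} := fun S hS _ => Finset.mem_singleton.1 hS
    simp [gregFamilies_one, hPoly, Finset.filter_singleton, this]
  | succ m ih =>
    have h : ∀ F ∈ gregFamilies (m + 1), ∑ S ∈ F, ∑ b ∈ insertOptions F S,
        (if IsZeroTop (m + 1 + 1) (insertLabel (m + 1) F S b.1 b.2) then
          (X : ℂ[X]) ^ ((insertLabel (m + 1) F S b.1 b.2).card - (m + 1 + 1)) else 0) =
        if IsZeroTop (m + 1) F then (((2 * m + 1 : ℕ) : ℂ[X]) + (m : ℂ[X]) * X) *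
          X ^ (F.card - (m + 1)) + (1 + X) ^ 2 * derivative (X ^ (F.card - (m + 1))) else 0 := by
      intro F hF
      have hF := mem_gregFamilies.1 hF
      split_ifs with h0
      · have := sum_sum_insertOptions_zeroTop (by omega) hF h0
        push_cast at this ⊢
        linear_combination this
      · refine Finset.sum_eq_zero fun S hS => Finset.sum_eq_zero fun b _ => if_neg fun h => ?_
        exact h0 ((isZeroTop_insertLabel (by omega) hF hS).1 h).1
    rw [Finset.sum_filter, sum_gregFamilies_succ (by omega), Finset.sum_congr rfl h,
      ← Finset.sum_filter, Finset.sum_add_distrib, ← Finset.mul_sum, ← Finset.mul_sum,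
      ← derivative_sum, ih, hPoly]

/-! ### Rooted trees as parent functions -/

section Parent

variable {V W : Type*}

/-- `p` is a parent function with root `r`: iterating `p` leads from every vertex to `r`, where it
stops. -/
structure IsParentFun (p : V → V) (r : V) : Prop where
  map_root : p r = r
  reaches : ∀ v, ∃ k, p^[k] v = r

/-- `v` lies on the way from `u` to the root. -/
def IsBelow (p : V → V) (u v : V) : Prop := ∃ k, p^[k] u = v

/-- The graph that joins every vertex to its parent. -/
def parentGraph (p : V → V) : SimpleGraph V where
  Adj u v := u ≠ v ∧ (p u = v ∨ p v = u)
  symm := ⟨fun _ _ h => ⟨h.1.symm, h.2.symm⟩⟩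
  loopless := ⟨fun _ h => h.1 rfl⟩

lemma isBelow_refl (p : V → V) (v : V) : IsBelow p v v := ⟨0, rfl⟩

lemma isBelow_parent (p : V → V) (v : V) : IsBelow p v (p v) := ⟨1, rfl⟩

lemma IsBelow.trans {p : V → V} {u v w : V} (h : IsBelow p u v) (h' : IsBelow p v w) :
    IsBelow p u w := by
  obtain ⟨a, rfl⟩ := h
  obtain ⟨b, rfl⟩ := h'
  exact ⟨b + a, Function.iterate_add_apply p b a u⟩

lemma IsBelow.total {p : V → V} {u v w : V} (h : IsBelow p u v) (h' : IsBelow p u w) :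
    IsBelow p v w ∨ IsBelow p w v := by
  obtain ⟨a, rfl⟩ := h
  obtain ⟨b, rfl⟩ := h'
  rcases le_total a b with hab | hab
  · left
    exact ⟨b - a, by rw [← Function.iterate_add_apply, Nat.sub_add_cancel hab]⟩
  · right
    exact ⟨a - b, by rw [← Function.iterate_add_apply, Nat.sub_add_cancel hab]⟩

lemma IsBelow.parent_of_ne {p : V → V} {u v : V} (h : IsBelow p u v) (hne : u ≠ v) :
    IsBelow p (p u) v := by
  obtain ⟨_ | k, rfl⟩ := h
  · exact absurd rfl hne
  · exact ⟨k, rfl⟩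

namespace IsParentFun

variable {p : V → V} {r : V}

lemma isBelow_root (hp : IsParentFun p r) (v : V) : IsBelow p v r := hp.reaches v

lemma iterate_root (hp : IsParentFun p r) (k : ℕ) : p^[k] r = r :=
  Function.iterate_fixed hp.map_root k

lemma eq_root_of_isBelow (hp : IsParentFun p r) {v : V} (h : IsBelow p r v) : v = r := by
  obtain ⟨k, rfl⟩ := h
  exact hp.iterate_root k

lemma eq_root_of_iterate_eq (hp : IsParentFun p r) {v : V} {k : ℕ} (h : p^[k + 1] v = v) :
    v = r := by
  obtain ⟨j, hj⟩ := hp.reaches v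
  have h1 : p^[(k + 1) * j] v = v := by
    rw [Function.iterate_mul]
    exact Function.iterate_fixed h j
  have h2 : (k + 1) * j = k * j + j := by ring
  rw [h2, Function.iterate_add_apply, hj, hp.iterate_root] at h1
  exact h1.symm

lemma eq_root_of_fixed (hp : IsParentFun p r) {v : V} (h : p v = v) : v = r :=
  hp.eq_root_of_iterate_eq (k := 0) h

lemma antisymm (hp : IsParentFun p r) {u v : V} (h : IsBelow p u v) (h' : IsBelow p v u) :
    u = v := by
  obtain ⟨_ | a, ha⟩ := h
  · exact ha
  · obtain ⟨b, hb⟩ := h'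
    have : u = r := by
      refine hp.eq_root_of_iterate_eq (k := b + a) ?_
      rw [add_assoc, Function.iterate_add_apply, ha, hb]
    rw [this, hp.iterate_root] at ha
    rw [this, ha]

/-- Two different vertices with the same parent have no common descendant. -/
lemma not_isBelow_of_parent_eq (hp : IsParentFun p r) {c d : V} (hcd : c ≠ d) (h : p c = p d)
    (hd : d ≠ p d) : ¬ IsBelow p c d := by
  intro hb
  have := hb.parent_of_ne hcd
  rw [h] at this
  exact hd (hp.antisymm (isBelow_parent p d) this)

/-- A rooted tree has only one parent function. -/
lemma unique {q : V → V} (hp : IsParentFun p r) (hq : IsParentFun q r)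
    (h : parentGraph p = parentGraph q) : p = q := by
  have key : ∀ k v, p^[k] v = r → p v = q v := by
    intro k
    induction k with
    | zero =>
      rintro v rfl
      exact hp.map_root.trans hq.map_root.symm
    | succ k ih =>
      intro v hv
      have hv' := ih (p v) hv
      by_cases hvr : v = r
      · rw [hvr, hp.map_root, hq.map_root]
      have hadj : (parentGraph p).Adj v (p v) :=
        ⟨fun h => hvr (hp.eq_root_of_fixed h.symm), Or.inl rfl⟩
      rw [h] at hadj
      rcases hadj.2 with h1 | h1
      · exact h1.symm
      · exact absurd (hp.eq_root_of_iterate_eq (k := 1) (hv'.trans h1)) hvr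
  funext v
  obtain ⟨k, hk⟩ := hp.reaches v
  exact key k v hk

lemma conj (hp : IsParentFun p r) (e : V ≃ W) : IsParentFun (e ∘ p ∘ e.symm) (e r) := by
  refine ⟨by simp [hp.map_root], fun w => ?_⟩
  obtain ⟨k, hk⟩ := hp.reaches (e.symm w)
  have h : Function.Semiconj e p (e ∘ p ∘ e.symm) := fun v => by simp
  refine ⟨k, ?_⟩
  rw [← hk, h.iterate_right k (e.symm w), e.apply_symm_apply]

lemma reachable_root (hp : IsParentFun p r) (v : V) : (parentGraph p).Reachable v r := by
  obtain ⟨k, hk⟩ := hp.reaches v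
  induction k generalizing v with
  | zero => exact hk ▸ SimpleGraph.Reachable.refl _
  | succ k ih =>
    refine SimpleGraph.Reachable.trans ?_ (ih (p v) hk)
    by_cases h : v = p v
    · rw [← h]
    · exact SimpleGraph.Adj.reachable ⟨h, Or.inl rfl⟩

lemma isTree_parentGraph [Finite V] (hp : IsParentFun p r) : (parentGraph p).IsTree := by
  classical
  have := Fintype.ofFinite V
  have hconn : (parentGraph p).Connected :=
    { preconnected := fun u v => (hp.reachable_root u).trans (hp.reachable_root v).symm
      nonempty := ⟨r⟩ }
  rw [SimpleGraph.isTree_iff_connected_and_card]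
  refine ⟨hconn, le_antisymm ?_ hconn.card_vert_le_card_edgeSet_add_one⟩
  have hsub : (parentGraph p).edgeFinset ⊆ (Finset.univ.erase r).image fun v => s(v, p v) := by
    intro e
    induction e with
    | h u v =>
      intro he
      have he : (parentGraph p).Adj u v := by simpa using he
      obtain ⟨hne, rfl | rfl⟩ := he
      · refine Finset.mem_image.2 ⟨u, Finset.mem_erase.2 ⟨?_, Finset.mem_univ _⟩, rfl⟩
        rintro rfl
        exact hne hp.map_root.symm
      · refine Finset.mem_image.2 ⟨v, Finset.mem_erase.2 ⟨?_, Finset.mem_univ _⟩, Sym2.eq_swap⟩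
        rintro rfl
        exact hne hp.map_root
  have h1 := (Finset.card_le_card hsub).trans Finset.card_image_le
  rw [Finset.card_erase_of_mem (Finset.mem_univ r), Finset.card_univ] at h1
  have h2 : 0 < Fintype.card V := Fintype.card_pos_iff.2 ⟨r⟩
  rw [Nat.card_eq_fintype_card, Nat.card_eq_fintype_card, ← SimpleGraph.edgeFinset_card]
  omega

/-- The degree condition on the unlabeled vertices of a rooted Greg tree says that they have at
least two children. -/
lemma degree_cond_iff [Fintype V] (hp : IsParentFun p r) (v : V)
    [Fintype ((parentGraph p).neighborSet v)] :
    (3 ≤ (parentGraph p).degree v ∨ (r = v ∧ (parentGraph p).degree v = 2)) ↔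
      ∃ c d, c ≠ d ∧ (p c = v ∧ c ≠ v) ∧ (p d = v ∧ d ≠ v) := by
  classical
  set C : Finset V := Finset.univ.filter fun c => p c = v ∧ c ≠ v with hC
  have hbranch : (∃ c d, c ≠ d ∧ (p c = v ∧ c ≠ v) ∧ (p d = v ∧ d ≠ v)) ↔ 1 < C.card := by
    rw [Finset.one_lt_card]
    simp only [hC, Finset.mem_filter, Finset.mem_univ, true_and]
    constructor
    · rintro ⟨c, d, h1, h2, h3⟩
      exact ⟨c, h2, d, h3, h1⟩
    · rintro ⟨c, h2, d, h3, h1⟩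
      exact ⟨c, d, h1, h2, h3⟩
  have hdeg : (parentGraph p).degree v = C.card + if r = v then 0 else 1 := by
    rw [← SimpleGraph.card_neighborFinset_eq_degree]
    split_ifs with h
    · rw [add_zero]
      congr 1
      ext c
      simp only [SimpleGraph.mem_neighborFinset, hC, Finset.mem_filter, Finset.mem_univ, true_and]
      constructor
      · rintro ⟨h1, h2 | h2⟩
        · rw [← h, hp.map_root, h] at h2
          exact absurd h2 h1
        · exact ⟨h2, h1.symm⟩
      · rintro ⟨h1, h2⟩
        exact ⟨h2.symm, Or.inr h1⟩
    · have hpv : p v ≠ v := fun h' => h (hp.eq_root_of_fixed h').symm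
      have hnot : p v ∉ C := by
        simp only [hC, Finset.mem_filter, Finset.mem_univ, true_and]
        rintro ⟨h1, _⟩
        exact h (hp.eq_root_of_iterate_eq (k := 1) h1).symm
      rw [← Finset.card_insert_of_notMem hnot]
      congr 1
      ext c
      simp only [SimpleGraph.mem_neighborFinset, hC, Finset.mem_insert, Finset.mem_filter,
        Finset.mem_univ, true_and]
      constructor
      · rintro ⟨h1, h2 | h2⟩
        · exact Or.inl h2.symm
        · exact Or.inr ⟨h2, h1.symm⟩
      · rintro (rfl | ⟨h1, h2⟩)
        · exact ⟨hpv.symm, Or.inl rfl⟩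
        · exact ⟨h2.symm, Or.inr h1⟩
  rw [hbranch, hdeg]
  split_ifs with h
  · simp only [h, true_and]
    omega
  · simp only [h, false_and, or_false]
    omega

end IsParentFun

/-- Every rooted tree has a parent function: send `v` to a neighbor that is nearer to the root.
Counting edges shows that no edge is missed. -/
lemma exists_isParentFun [Finite V] {G : SimpleGraph V} (hG : G.IsTree) (r : V) :
    ∃ p, IsParentFun p r ∧ G = parentGraph p := by
  classical
  have := Fintype.ofFinite V
  have hex : ∀ v, v ≠ r → ∃ w, G.Adj v w ∧ G.dist w r < G.dist v r := by
    intro v hv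
    obtain ⟨w, hw⟩ := (hG.connected.preconnected v r).exists_walk_length_eq_dist
    cases w with
    | nil => exact absurd rfl hv
    | cons h w' =>
      refine ⟨_, h, lt_of_le_of_lt (SimpleGraph.dist_le w') ?_⟩
      rw [← hw, SimpleGraph.Walk.length_cons]
      exact Nat.lt_succ_self _
  choose! f hf using hex
  obtain ⟨p, hp⟩ : ∃ p : V → V, p = fun v => if v = r then r else f v := ⟨_, rfl⟩
  have hpr : p r = r := by simp [hp]
  have hpv : ∀ v, v ≠ r → G.Adj v (p v) ∧ G.dist (p v) r < G.dist v r := fun v hv => by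
    simpa [hp, hv] using hf v hv
  have hsub : (Finset.univ.erase r).image (fun v => s(v, p v)) ⊆ G.edgeFinset := by
    intro e he
    obtain ⟨v, hv, rfl⟩ := Finset.mem_image.1 he
    simpa using (hpv v (Finset.mem_erase.1 hv).1).1
  have hinj : Set.InjOn (fun v => s(v, p v)) (Finset.univ.erase r : Finset V) := by
    intro u hu v hv h
    have hu := (hpv u (Finset.mem_erase.1 hu).1).2
    have hv := (hpv v (Finset.mem_erase.1 hv).1).2
    rcases Sym2.eq_iff.1 h with h | h
    · exact h.1
    · rw [h.2] at hu
      rw [← h.1] at hv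
      exact absurd hu hv.le.not_gt
  have hedges := Finset.eq_of_subset_of_card_le hsub (by
    rw [Finset.card_image_of_injOn hinj, Finset.card_erase_of_mem (Finset.mem_univ r),
      Finset.card_univ]
    have := hG.card_edgeFinset
    omega)
  refine ⟨p, ⟨hpr, fun v => ?_⟩, ?_⟩
  · generalize hd : G.dist v r = d
    induction d using Nat.strong_induction_on generalizing v with
    | _ d ih =>
      by_cases hv : v = r
      · exact ⟨0, hv⟩
      · obtain ⟨k, hk⟩ := ih _ (hd ▸ (hpv v hv).2) (p v) rfl
        exact ⟨k + 1, hk⟩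
  · ext u v
    constructor
    · intro h
      refine ⟨h.ne, ?_⟩
      have : s(u, v) ∈ G.edgeFinset := by simpa using h
      rw [← hedges] at this
      obtain ⟨w, _, hw⟩ := Finset.mem_image.1 this
      rcases Sym2.eq_iff.1 hw with ⟨rfl, h'⟩ | ⟨rfl, h'⟩
      · exact Or.inl h'
      · exact Or.inr h'
    · rintro ⟨hne, rfl | rfl⟩
      · refine (hpv u ?_).1
        rintro rfl
        exact hne hpr.symm
      · refine (hpv v ?_).1.symm
        rintro rfl
        exact hne hpr

end Parent

/-! ### The family of a rooted Greg tree -/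

section GregParent

variable {V W : Type*} {n : ℕ}

/-- A rooted Greg tree of size `n`, given by the parent function `p`, the root `r` and the labels
`ℓ`: every vertex without label has at least two children. -/
structure IsGregParent (p : V → V) (r : V) (ℓ : Fin n → V) : Prop extends IsParentFun p r where
  inj : Function.Injective ℓ
  branch : ∀ v, (∃ i, ℓ i = v) ∨ ∃ c d, c ≠ d ∧ (p c = v ∧ c ≠ v) ∧ (p d = v ∧ d ≠ v)

open Classical in
/-- The set of labels at or below the vertex `v`. -/
noncomputable def cluster (p : V → V) (ℓ : Fin n → V) (v : V) : Finset ℕ :=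
  (Finset.range n).filter fun x => ∃ h : x < n, IsBelow p (ℓ ⟨x, h⟩) v

lemma mem_cluster {p : V → V} {ℓ : Fin n → V} {v : V} {x : ℕ} :
    x ∈ cluster p ℓ v ↔ ∃ h : x < n, IsBelow p (ℓ ⟨x, h⟩) v := by
  simp only [cluster, Finset.mem_filter, Finset.mem_range, and_iff_right_iff_imp]
  exact fun h => h.1

lemma coe_mem_cluster {p : V → V} {ℓ : Fin n → V} {v : V} {i : Fin n} :
    (i : ℕ) ∈ cluster p ℓ v ↔ IsBelow p (ℓ i) v :=
  mem_cluster.trans ⟨fun h => h.2, fun h => ⟨i.2, h⟩⟩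

lemma cluster_mono {p : V → V} {ℓ : Fin n → V} {u v : V} (h : IsBelow p u v) :
    cluster p ℓ u ⊆ cluster p ℓ v := by
  intro x hx
  obtain ⟨hn, hx⟩ := mem_cluster.1 hx
  exact mem_cluster.2 ⟨hn, hx.trans h⟩

lemma cluster_map {p : V → V} {q : W → W} {φ : V → W} (hφ : Function.Injective φ)
    (h : Function.Semiconj φ p q) (ℓ : Fin n → V) (v : V) :
    cluster q (φ ∘ ℓ) (φ v) = cluster p ℓ v := by
  ext x
  simp only [mem_cluster, IsBelow, Function.comp_apply]
  refine exists_congr fun hx => exists_congr fun k => ?_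
  rw [← h.iterate_right k (ℓ ⟨x, hx⟩), hφ.eq_iff]

open Classical in
/-- The family of all clusters of a rooted tree. -/
noncomputable def clusterFamily [Fintype V] (p : V → V) (ℓ : Fin n → V) : Finset (Finset ℕ) :=
  Finset.univ.image (cluster p ℓ)

lemma mem_clusterFamily [Fintype V] {p : V → V} {ℓ : Fin n → V} {S : Finset ℕ} :
    S ∈ clusterFamily p ℓ ↔ ∃ v, cluster p ℓ v = S := by
  simp [clusterFamily]

lemma cluster_mem_clusterFamily [Fintype V] (p : V → V) (ℓ : Fin n → V) (v : V) :
    cluster p ℓ v ∈ clusterFamily p ℓ :=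
  mem_clusterFamily.2 ⟨v, rfl⟩

lemma clusterFamily_conj [Fintype V] [Fintype W] (p : V → V) (ℓ : Fin n → V) (e : V ≃ W) :
    clusterFamily (e ∘ p ∘ e.symm) (e ∘ ℓ) = clusterFamily p ℓ := by
  have h : Function.Semiconj e p (e ∘ p ∘ e.symm) := fun v => by simp
  ext S
  rw [mem_clusterFamily, mem_clusterFamily, ← e.exists_congr_right]
  simp only [cluster_map e.injective h]

namespace IsGregParent

variable {p : V → V} {r : V} {ℓ : Fin n → V}

lemma conj (hp : IsGregParent p r ℓ) (e : V ≃ W) :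
    IsGregParent (e ∘ p ∘ e.symm) (e r) (e ∘ ℓ) := by
  refine ⟨hp.toIsParentFun.conj e, e.injective.comp hp.inj, fun w => ?_⟩
  rcases hp.branch (e.symm w) with ⟨i, hi⟩ | ⟨c, d, hcd, hc, hd⟩
  · exact Or.inl ⟨i, by simp [hi]⟩
  · refine Or.inr ⟨e c, e d, e.injective.ne hcd, ⟨by simp [hc.1], ?_⟩, ⟨by simp [hd.1], ?_⟩⟩
    · exact fun h => hc.2 (by simp [← h])
    · exact fun h => hd.2 (by simp [← h])

lemma cluster_root (hp : IsGregParent p r ℓ) : cluster p ℓ r = Finset.range n := by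
  ext x
  rw [mem_cluster, Finset.mem_range]
  exact ⟨fun h => h.1, fun h => ⟨h, hp.isBelow_root _⟩⟩

/-- Descending through unlabeled vertices ends at a label. -/
lemma cluster_nonempty [Finite V] (hp : IsGregParent p r ℓ) (v : V) :
    (cluster p ℓ v).Nonempty := by
  have hwf : WellFounded fun u v : V => IsBelow p u v ∧ u ≠ v := by
    have : IsTrans V fun u v : V => IsBelow p u v ∧ u ≠ v := ⟨fun a b c h1 h2 =>
      ⟨h1.1.trans h2.1, fun hac => h1.2 (hp.antisymm h1.1 (hac ▸ h2.1))⟩⟩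
    have : Std.Irrefl fun u v : V => IsBelow p u v ∧ u ≠ v := ⟨fun a h => h.2 rfl⟩
    exact Finite.wellFounded_of_trans_of_irrefl _
  induction v using hwf.induction with
  | _ v ih =>
    rcases hp.branch v with ⟨i, rfl⟩ | ⟨c, _, _, ⟨rfl, hc⟩, _⟩
    · exact ⟨i, coe_mem_cluster.2 (isBelow_refl _ _)⟩
    · exact (ih c ⟨isBelow_parent p c, hc⟩).mono (cluster_mono (isBelow_parent p c))

lemma isBelow_or_isBelow {u v : V} {x : ℕ} (hu : x ∈ cluster p ℓ u) (hv : x ∈ cluster p ℓ v) :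
    IsBelow p u v ∨ IsBelow p v u :=
  (mem_cluster.1 hu).2.total (mem_cluster.1 hv).2

/-- The order of a rooted Greg tree is the inclusion of clusters: at an unlabeled vertex, two
children have disjoint clusters, so the cluster of one child is smaller than that of the vertex. -/
lemma cluster_subset_iff [Finite V] (hp : IsGregParent p r ℓ) {u v : V} :
    cluster p ℓ u ⊆ cluster p ℓ v ↔ IsBelow p u v := by
  refine ⟨fun h => ?_, cluster_mono⟩
  obtain ⟨x, hx⟩ := hp.cluster_nonempty u
  rcases isBelow_or_isBelow hx (h hx) with hb | hb
  · exact hb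
  by_cases huv : v = u
  · exact huv ▸ isBelow_refl p v
  rcases hp.branch u with ⟨i, rfl⟩ | ⟨c, d, hcd, hc, hd⟩
  · exact coe_mem_cluster.1 (h (coe_mem_cluster.2 (isBelow_refl _ _)))
  · -- one of the children, say `c'`, does not lie above `v`
    have key : ∀ c', p c' = u → c' ≠ u → (∀ b, p b = u → b ≠ u → IsBelow p v b → b ≠ c') →
        False := by
      intro c' h1 h2 h3
      obtain ⟨y, hy⟩ := hp.cluster_nonempty c'
      have hyv : y ∈ cluster p ℓ v := h (cluster_mono (h1 ▸ isBelow_parent p c') hy)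
      rcases isBelow_or_isBelow hy hyv with h4 | h4
      · by_cases h5 : c' = v
        · exact h3 c' h1 h2 (h5 ▸ isBelow_refl p c') rfl
        · have := h4.parent_of_ne h5
          rw [h1] at this
          exact huv (hp.antisymm hb this)
      · exact h3 c' h1 h2 h4 rfl
    by_cases hvc : IsBelow p v c
    · refine (key d hd.1 hd.2 fun b hb1 hb2 hvb hbd => ?_).elim
      subst hbd
      rcases hvc.total hvb with h1 | h1
      · exact hp.not_isBelow_of_parent_eq hcd (hc.1.trans hd.1.symm) (hd.1 ▸ hd.2) h1
      · exact hp.not_isBelow_of_parent_eq hcd.symm (hd.1.trans hc.1.symm) (hc.1 ▸ hc.2) h1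
    · refine (key c hc.1 hc.2 fun b _ _ hvb hbc => ?_).elim
      exact hvc (hbc ▸ hvb)

lemma cluster_injective [Finite V] (hp : IsGregParent p r ℓ) :
    Function.Injective (cluster p ℓ) := fun _ _ h =>
  hp.antisymm (hp.cluster_subset_iff.1 h.le) (hp.cluster_subset_iff.1 h.ge)

lemma card_clusterFamily [Fintype V] (hp : IsGregParent p r ℓ) :
    (clusterFamily p ℓ).card = Fintype.card V := by
  rw [clusterFamily, Finset.card_image_of_injective _ hp.cluster_injective, Finset.card_univ]

lemma isGregFamily [Fintype V] (hp : IsGregParent p r ℓ) :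
    IsGregFamily n (clusterFamily p ℓ) := by
  refine ⟨fun S hS => ?_, fun S hS => ?_, ?_, fun S hS U hU => ?_, fun i hi j hj hij => ?_⟩
  · obtain ⟨v, rfl⟩ := mem_clusterFamily.1 hS
    exact hp.cluster_nonempty v
  · obtain ⟨v, rfl⟩ := mem_clusterFamily.1 hS
    exact fun x hx => Finset.mem_range.2 (mem_cluster.1 hx).1
  · exact mem_clusterFamily.2 ⟨r, hp.cluster_root⟩
  · obtain ⟨u, rfl⟩ := mem_clusterFamily.1 hS
    obtain ⟨v, rfl⟩ := mem_clusterFamily.1 hU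
    by_cases hd : Disjoint (cluster p ℓ u) (cluster p ℓ v)
    · exact Or.inr (Or.inr hd)
    · obtain ⟨x, hx⟩ := Finset.not_disjoint_iff.1 hd
      rcases isBelow_or_isBelow hx.1 hx.2 with h | h
      · exact Or.inl (cluster_mono h)
      · exact Or.inr (Or.inl (cluster_mono h))
  · have h1 := (hij _ (cluster_mem_clusterFamily p ℓ (ℓ ⟨i, hi⟩))).1
      (mem_cluster.2 ⟨hi, isBelow_refl _ _⟩)
    have h2 := (hij _ (cluster_mem_clusterFamily p ℓ (ℓ ⟨j, hj⟩))).2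
      (mem_cluster.2 ⟨hj, isBelow_refl _ _⟩)
    have := hp.inj (hp.antisymm (mem_cluster.1 h2).2 (mem_cluster.1 h1).2)
    exact congrArg Fin.val this

lemma isZeroTop_iff [Fintype V] (hp : IsGregParent p r ℓ) (hn : 0 < n) :
    IsZeroTop n (clusterFamily p ℓ) ↔ r = ℓ ⟨0, hn⟩ := by
  constructor
  · intro h
    have := h _ (cluster_mem_clusterFamily p ℓ (ℓ ⟨0, hn⟩)) (mem_cluster.2 ⟨hn, isBelow_refl _ _⟩)
    rw [← hp.cluster_root] at this
    exact (hp.cluster_injective this).symm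
  · intro h S hS h0
    obtain ⟨v, rfl⟩ := mem_clusterFamily.1 hS
    rw [← hp.cluster_root]
    congr 1
    obtain ⟨_, h0⟩ := mem_cluster.1 h0
    rw [← h] at h0
    exact hp.eq_root_of_isBelow h0

/-- A rooted Greg tree is determined up to isomorphism by its family. -/
lemma exists_equiv [Fintype V] [Fintype W] {q : W → W} {s : W} {ℓ' : Fin n → W}
    (hp : IsGregParent p r ℓ) (hq : IsGregParent q s ℓ')
    (h : clusterFamily p ℓ = clusterFamily q ℓ') :
    ∃ φ : V ≃ W, (∀ v, φ (p v) = q (φ v)) ∧ φ r = s ∧ ∀ i, φ (ℓ i) = ℓ' i := by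
  have h1 : ∀ v, ∃ w, cluster q ℓ' w = cluster p ℓ v := fun v =>
    mem_clusterFamily.1 (h ▸ cluster_mem_clusterFamily p ℓ v)
  have h2 : ∀ w, ∃ v, cluster p ℓ v = cluster q ℓ' w := fun w =>
    mem_clusterFamily.1 (h.symm ▸ cluster_mem_clusterFamily q ℓ' w)
  choose f hf using h1
  choose g hg using h2
  obtain ⟨φ, hφ⟩ : ∃ φ : V ≃ W, ∀ v, φ v = f v :=
    ⟨⟨f, g, fun v => hp.cluster_injective ((hg _).trans (hf v)),
      fun w => hq.cluster_injective ((hf _).trans (hg w))⟩, fun _ => rfl⟩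
  have hφc : ∀ v, cluster q ℓ' (φ v) = cluster p ℓ v := fun v => by rw [hφ, hf]
  have hφb : ∀ {u v}, IsBelow q (φ u) (φ v) ↔ IsBelow p u v := fun {u v} => by
    rw [← hq.cluster_subset_iff, ← hp.cluster_subset_iff, hφc, hφc]
  have hr : φ r = s := hq.cluster_injective ((hφc r).trans (hp.cluster_root.trans
    hq.cluster_root.symm))
  refine ⟨φ, fun v => ?_, hr, fun i => ?_⟩
  · by_cases hv : v = r
    · rw [hv, hp.map_root, hr, hq.map_root]
    · -- in both trees the parent is the least vertex strictly above
      have hv' : φ v ≠ s := fun h => hv (φ.injective (h.trans hr.symm))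
      have hb : IsBelow p v (φ.symm (q (φ v))) := by
        rw [← hφb, φ.apply_symm_apply]
        exact isBelow_parent q _
      have hne : v ≠ φ.symm (q (φ v)) := by
        rw [Ne, φ.eq_symm_apply]
        exact fun h => hv' (hq.eq_root_of_fixed h.symm)
      have h3 := hφb.2 (hb.parent_of_ne hne)
      rw [φ.apply_symm_apply] at h3
      refine hq.antisymm h3 ((hφb.2 (isBelow_parent p v)).parent_of_ne ?_)
      exact fun h => hv (hp.eq_root_of_fixed (φ.injective h).symm)
  · refine hq.antisymm ?_ ?_
    · obtain ⟨v, hv⟩ := φ.surjective (ℓ' i)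
      rw [← hv, hφb, ← coe_mem_cluster, ← hφc, coe_mem_cluster, hv]
      exact isBelow_refl _ _
    · rw [← coe_mem_cluster, hφc, coe_mem_cluster]
      exact isBelow_refl _ _

end IsGregParent

/-! ### The rooted Greg tree of a family -/

/-- Every Greg family is the family of a rooted Greg tree, with the members of the family as
vertices: the parent of a member is the least member that properly contains it. -/
lemma IsGregFamily.exists_isGregParent {F : Finset (Finset ℕ)} (hF : IsGregFamily n F) :
    ∃ (p : F → F) (r : F) (ℓ : Fin n → F), IsGregParent p r ℓ ∧ clusterFamily p ℓ = F := by
  classical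
  obtain ⟨r, hr⟩ : ∃ r : F, r = ⟨Finset.range n, hF.top_mem⟩ := ⟨_, rfl⟩
  have htop : ∀ S : F, S.1 ⊆ r.1 := fun S => by rw [hr]; exact hF.subset S.1 S.2
  have hpex : ∀ S : F, S ≠ r → ∃ P : F, S.1 ⊂ P.1 ∧ ∀ U : F, S.1 ⊂ U.1 → P.1 ⊆ U.1 := by
    intro S hS
    obtain ⟨x, hx⟩ := hF.nonempty S.1 S.2
    obtain ⟨P, hP, h1, h2⟩ := hF.exists_least (fun U => S.1 ⊂ U) (x := x) (fun U _ h => h.1 hx)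
      ⟨r.1, r.2, (htop S).ssubset_of_ne fun h => hS (Subtype.ext h)⟩
    exact ⟨⟨P, hP⟩, h1, fun U hU => h2 U.1 U.2 hU⟩
  choose! f hf using hpex
  obtain ⟨p, hp⟩ : ∃ p : F → F, p = fun S => if S = r then r else f S := ⟨_, rfl⟩
  have hpr : p r = r := by simp [hp]
  have hpS : ∀ S, S ≠ r → S.1 ⊂ (p S).1 ∧ ∀ U : F, S.1 ⊂ U.1 → (p S).1 ⊆ U.1 := fun S hS => by
    simpa [hp, hS] using hf S hS
  have hsub : ∀ S, S.1 ⊆ (p S).1 := fun S => by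
    by_cases hS : S = r
    · rw [hS, hpr]
    · exact (hpS S hS).1.1
  have hbelow : ∀ S U : F, IsBelow p S U ↔ S.1 ⊆ U.1 := by
    intro S U
    constructor
    · rintro ⟨k, rfl⟩
      induction k with
      | zero => exact subset_rfl
      | succ k ih =>
        rw [Function.iterate_succ_apply']
        exact ih.trans (hsub _)
    · generalize hd : n - S.1.card = d
      induction d using Nat.strong_induction_on generalizing S with
      | _ d ih =>
        intro h
        by_cases hSU : S = U
        · exact hSU ▸ isBelow_refl p S
        · have hss : S.1 ⊂ U.1 := h.ssubset_of_ne fun h => hSU (Subtype.ext h)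
          have hSr : S ≠ r := by
            rintro rfl
            exact hss.2 (htop U)
          have hcard := Finset.card_lt_card (hpS S hSr).1
          have hle := Finset.card_le_card (hF.subset (p S).1 (p S).2)
          rw [Finset.card_range] at hle
          exact (isBelow_parent p S).trans
            (ih _ (by omega) (p S) rfl ((hpS S hSr).2 U hss))
  choose! o ho using fun i hi => hF.exists_isOwner (i := i) hi
  obtain ⟨ℓ, hℓ⟩ : ∃ ℓ : Fin n → F, ∀ i : Fin n, IsOwner F i (ℓ i).1 :=
    ⟨fun i => ⟨o i, (ho i i.2).1⟩, fun i => ho i i.2⟩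
  have hcl : ∀ S : F, cluster p ℓ S = S.1 := by
    intro S
    ext x
    rw [mem_cluster]
    constructor
    · rintro ⟨hx, h⟩
      exact (hbelow _ _).1 h (hℓ ⟨x, hx⟩).2.1
    · intro hx
      refine ⟨Finset.mem_range.1 (hF.subset S.1 S.2 hx), (hbelow _ _).2 ?_⟩
      exact (hℓ ⟨x, _⟩).2.2 S.1 S.2 hx
  refine ⟨p, r, ℓ, ⟨⟨hpr, fun v => (hbelow v r).2 (htop v)⟩, fun i j hij => ?_, fun S => ?_⟩, ?_⟩
  · have h := hℓ i
    rw [hij] at h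
    exact Fin.ext (hF.isOwner_inj h (hℓ j))
  · by_cases hS : ∃ i, ℓ i = S
    · exact Or.inl hS
    -- every label in an unlabeled member lies in a maximal proper submember, that is, in a child
    have hchild : ∀ i ∈ S.1, ∃ C : F, i ∈ C.1 ∧ p C = S ∧ C ≠ S := by
      intro i hi
      have hin : i < n := Finset.mem_range.1 (hF.subset S.1 S.2 hi)
      have hex : ∃ U ∈ F, i ∈ U ∧ U ⊂ S.1 := by
        refine ⟨(ℓ ⟨i, hin⟩).1, (ℓ ⟨i, hin⟩).2, (hℓ ⟨i, hin⟩).2.1, ?_⟩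
        refine ((hℓ ⟨i, hin⟩).2.2 S.1 S.2 hi).ssubset_of_ne fun h => hS ⟨_, Subtype.ext h⟩
      obtain ⟨C, hC, ⟨hiC, hCS⟩, hmax⟩ := hF.exists_greatest (fun U => i ∈ U ∧ U ⊂ S.1) (x := i)
        (fun _ _ h => h.1) hex
      have hCr : (⟨C, hC⟩ : F) ≠ r := by
        intro h
        have hCr : C = r.1 := congrArg Subtype.val h
        exact hCS.2 (by rw [hCr]; exact htop S)
      have h1 := hpS _ hCr
      refine ⟨⟨C, hC⟩, hiC, ?_, fun h => hCS.ne (congrArg Subtype.val h)⟩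
      by_contra hne
      have h2 : (p ⟨C, hC⟩).1 ⊂ S.1 :=
        (h1.2 S hCS).ssubset_of_ne fun h => hne (Subtype.ext h)
      exact h1.1.2 (hmax _ (p ⟨C, hC⟩).2 ⟨h1.1.1 hiC, h2⟩)
    obtain ⟨i, hi⟩ := hF.nonempty S.1 S.2
    obtain ⟨C, hiC, hpC, hCS⟩ := hchild i hi
    have hCsub : C.1 ⊂ S.1 :=
      (hpC ▸ hsub C).ssubset_of_ne fun h => hCS (Subtype.ext h)
    obtain ⟨j, hj, hjC⟩ := Finset.exists_of_ssubset hCsub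
    obtain ⟨D, hjD, hpD, hDS⟩ := hchild j hj
    refine Or.inr ⟨C, D, ?_, ⟨hpC, hCS⟩, ⟨hpD, hDS⟩⟩
    rintro rfl
    exact hjC hjD
  · ext S
    rw [mem_clusterFamily]
    constructor
    · rintro ⟨v, rfl⟩
      rw [hcl]
      exact v.2
    · exact fun hS => ⟨⟨S, hS⟩, hcl _⟩

end GregParent

/-! ### Greg trees and families -/

lemma RootedGregTreeRep.exists_isGregParent {n : ℕ} (T : RootedGregTreeRep n) :
    ∃ p : Fin n ⊕ Fin T.unl → Fin n ⊕ Fin T.unl,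
      IsGregParent p T.root Sum.inl ∧ T.graph = parentGraph p := by
  classical
  obtain ⟨unl, G, r, hG, hdeg⟩ := T
  obtain ⟨p, hp, rfl⟩ := exists_isParentFun hG r
  refine ⟨p, ⟨hp, Sum.inl_injective, fun v => ?_⟩, rfl⟩
  rcases v with i | j
  · exact Or.inl ⟨i, rfl⟩
  · refine Or.inr ((hp.degree_cond_iff (Sum.inr j)).1 ?_)
    convert hdeg j

/-- The parent function of a rooted Greg tree. -/
noncomputable def RootedGregTreeRep.parent {n : ℕ} (T : RootedGregTreeRep n) :
    Fin n ⊕ Fin T.unl → Fin n ⊕ Fin T.unl :=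
  T.exists_isGregParent.choose

lemma RootedGregTreeRep.isGregParent {n : ℕ} (T : RootedGregTreeRep n) :
    IsGregParent T.parent T.root Sum.inl :=
  T.exists_isGregParent.choose_spec.1

lemma RootedGregTreeRep.graph_eq {n : ℕ} (T : RootedGregTreeRep n) :
    T.graph = parentGraph T.parent :=
  T.exists_isGregParent.choose_spec.2

/-- The family of label sets below the vertices of a rooted Greg tree. -/
noncomputable def RootedGregTreeRep.family {n : ℕ} (T : RootedGregTreeRep n) :
    Finset (Finset ℕ) :=
  clusterFamily T.parent Sum.inl

lemma RootedGregTreeRep.card_family {n : ℕ} (T : RootedGregTreeRep n) :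
    T.family.card = n + T.unl := by
  rw [family, T.isGregParent.card_clusterFamily]
  simp

lemma parentGraph_conj_adj {V W : Type*} (p : V → V) (e : V ≃ W) (u v : V) :
    (parentGraph (e ∘ p ∘ e.symm)).Adj (e u) (e v) ↔ (parentGraph p).Adj u v := by
  simp [parentGraph]

/-- The family is a complete isomorphism invariant of rooted Greg trees. -/
lemma RootedGregTreeRep.family_eq_iff {n : ℕ} (T T' : RootedGregTreeRep n) :
    T.family = T'.family ↔ T ≈ T' := by
  constructor
  · intro h
    obtain ⟨φ, h1, h2, h3⟩ := T.isGregParent.exists_equiv T'.isGregParent h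
    refine ⟨⟨φ, fun {u v} => ?_⟩, h3, h2⟩
    rw [T.graph_eq, T'.graph_eq]
    have : T'.parent = φ ∘ T.parent ∘ φ.symm := by
      funext w
      simp [h1]
    rw [this]
    exact parentGraph_conj_adj _ φ u v
  · rintro ⟨φ, h1, h2⟩
    have hconj := T.isGregParent.conj φ.toEquiv
    have hroot : φ.toEquiv T.root = T'.root := h2
    rw [hroot] at hconj
    have hg : parentGraph (φ.toEquiv ∘ T.parent ∘ φ.toEquiv.symm) = parentGraph T'.parent := by
      rw [← T'.graph_eq]
      ext u v
      obtain ⟨u, rfl⟩ := φ.toEquiv.surjective u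
      obtain ⟨v, rfl⟩ := φ.toEquiv.surjective v
      rw [parentGraph_conj_adj, ← T.graph_eq]
      exact φ.map_rel_iff.symm
    have hp := hconj.toIsParentFun.unique T'.isGregParent.toIsParentFun hg
    have hl : (φ.toEquiv ∘ Sum.inl : Fin n → _) = Sum.inl := funext h1
    rw [family, family, ← hp, ← clusterFamily_conj T.parent Sum.inl φ.toEquiv, hl]

/-- A vertex set with `n` labels can be renamed so that the labels become the `inl i`. -/
lemma exists_equiv_sum {V : Type*} [Finite V] {n : ℕ} {ℓ : Fin n → V}
    (hℓ : Function.Injective ℓ) :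
    ∃ (k : ℕ) (e : V ≃ Fin n ⊕ Fin k), e ∘ ℓ = Sum.inl := by
  classical
  have := Fintype.ofFinite V
  refine ⟨Fintype.card ↥(Set.range ℓ)ᶜ, (Equiv.Set.sumCompl (Set.range ℓ)).symm.trans
    (Equiv.sumCongr (Equiv.ofInjective ℓ hℓ).symm (Fintype.equivFin _)), funext fun i => ?_⟩
  have h := Equiv.Set.sumCompl_symm_apply_of_mem (s := Set.range ℓ) (Set.mem_range_self i)
  simp only [Function.comp_apply, Equiv.trans_apply, h, Equiv.sumCongr_apply, Sum.map_inl]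
  exact congrArg Sum.inl (Equiv.ofInjective_symm_apply hℓ i)

lemma RootedGregTreeRep.exists_family_eq {n : ℕ} {F : Finset (Finset ℕ)}
    (hF : IsGregFamily n F) : ∃ T : RootedGregTreeRep n, T.family = F := by
  classical
  obtain ⟨p, r, ℓ, hp, hpF⟩ := hF.exists_isGregParent
  obtain ⟨k, e, he⟩ := exists_equiv_sum hp.inj
  have hq := hp.conj e
  have hfam := clusterFamily_conj p ℓ e
  rw [he] at hq hfam
  refine ⟨⟨k, parentGraph (e ∘ p ∘ e.symm), e r,
      hq.isTree_parentGraph, fun j => (hq.degree_cond_iff _).2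
        ((hq.branch (Sum.inr j)).resolve_left fun ⟨_, hi⟩ => Sum.inl_ne_inr hi)⟩,
    Eq.trans ?_ (hfam.trans hpF)⟩
  rw [family]
  congr 1
  exact (RootedGregTreeRep.isGregParent _).toIsParentFun.unique hq.toIsParentFun
    (RootedGregTreeRep.graph_eq _).symm

/-- The family of label sets below the vertices of a rooted Greg tree. -/
noncomputable def RootedGregTree.family {n : ℕ} (T : RootedGregTree n) : Finset (Finset ℕ) :=
  Quotient.lift RootedGregTreeRep.family (fun T T' h => (T.family_eq_iff T').2 h) T

lemma RootedGregTree.family_injective (n : ℕ) :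
    Function.Injective (RootedGregTree.family (n := n)) := by
  intro T T' h
  induction T using Quotient.inductionOn with
  | h T => induction T' using Quotient.inductionOn with
    | h T' => exact Quotient.sound ((T.family_eq_iff T').1 h)

lemma RootedGregTree.family_mem {n : ℕ} (T : RootedGregTree n) :
    T.family ∈ gregFamilies n := by
  induction T using Quotient.inductionOn with
  | h T => exact mem_gregFamilies.2 T.isGregParent.isGregFamily

lemma RootedGregTree.card_family {n : ℕ} (T : RootedGregTree n) :
    T.family.card = n + T.unl := by
  induction T using Quotient.inductionOn with
  | h T => exact T.card_family

/-- A Greg tree with at least one label, rooted at the vertex with the label `0`. -/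
def GregTreeRep.rooted {n : ℕ} (hn : 0 < n) (T : GregTreeRep n) : RootedGregTreeRep n where
  unl := T.unl
  graph := T.graph
  root := Sum.inl ⟨0, hn⟩
  isTree := T.isTree
  degree_cond := fun j => Or.inl (T.three_le_degree j)

/-- A Greg tree with at least one label, rooted at the vertex with the label `0`. -/
def GregTree.rooted {n : ℕ} (hn : 0 < n) (T : GregTree n) : RootedGregTree n :=
  Quotient.map (GregTreeRep.rooted hn) (by
    rintro T T' ⟨φ, hφ⟩
    exact ⟨φ, hφ, hφ _⟩) T

lemma GregTree.rooted_injective {n : ℕ} (hn : 0 < n) :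
    Function.Injective (GregTree.rooted hn) := by
  intro T T' h
  induction T using Quotient.inductionOn with
  | h T => induction T' using Quotient.inductionOn with
    | h T' =>
      obtain ⟨φ, hφ, _⟩ := Quotient.exact h
      exact Quotient.sound ⟨φ, hφ⟩

lemma GregTree.unl_rooted {n : ℕ} (hn : 0 < n) (T : GregTree n) :
    (T.rooted hn).unl = T.unl := by
  induction T using Quotient.inductionOn with
  | h T => rfl

open Classical in
lemma GregTree.family_rooted_mem {n : ℕ} (hn : 0 < n) (T : GregTree n) :
    (T.rooted hn).family ∈ (gregFamilies n).filter (IsZeroTop n) := by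
  refine Finset.mem_filter.2 ⟨RootedGregTree.family_mem _, ?_⟩
  induction T using Quotient.inductionOn with
  | h T => exact ((T.rooted hn).isGregParent.isZeroTop_iff hn).2 rfl

open Classical in
lemma GregTree.exists_family_rooted_eq {n : ℕ} (hn : 0 < n) {F : Finset (Finset ℕ)}
    (hF : F ∈ (gregFamilies n).filter (IsZeroTop n)) :
    ∃ T : GregTree n, (T.rooted hn).family = F := by
  obtain ⟨hF, h0⟩ := Finset.mem_filter.1 hF
  obtain ⟨T, rfl⟩ := RootedGregTreeRep.exists_family_eq (mem_gregFamilies.1 hF)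
  have hroot := (T.isGregParent.isZeroTop_iff hn).1 h0
  obtain ⟨unl, G, r, hG, hdeg⟩ := T
  obtain rfl : r = Sum.inl ⟨0, hn⟩ := hroot
  exact ⟨Quotient.mk _ ⟨unl, G, hG, fun j => (hdeg j).resolve_right fun h => by simp at h⟩, rfl⟩

lemma finsum_pow_unl_eq {ι : Type*} {n : ℕ} {s : Finset (Finset (Finset ℕ))} {u : ι → ℕ}
    {g : ι → Finset (Finset ℕ)} (hg : Function.Injective g) (hmem : ∀ T, g T ∈ s)
    (hsurj : ∀ F ∈ s, ∃ T, g T = F) (hcard : ∀ T, (g T).card = n + u T) :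
    Finite ι ∧ ∑ᶠ T, (X : ℂ[X]) ^ u T = ∑ F ∈ s, X ^ (F.card - n) := by
  have hb : Function.Bijective fun T => (⟨g T, hmem T⟩ : s) :=
    ⟨fun T T' h => hg (congrArg Subtype.val h), fun F => by
      obtain ⟨T, hT⟩ := hsurj F.1 F.2
      exact ⟨T, Subtype.ext hT⟩⟩
  refine ⟨Finite.of_injective _ hb.1, ?_⟩
  rw [← Finset.sum_coe_sort, ← finsum_eq_sum_of_fintype]
  exact finsum_eq_of_bijective _ hb fun T => by simp [hcard]

lemma RootedGregTree.finsum_pow_unl (m : ℕ) : Finite (RootedGregTree (m + 1)) ∧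
    ∑ᶠ T : RootedGregTree (m + 1), (X : ℂ[X]) ^ T.unl = gPoly m := by
  rw [← sum_gregFamilies]
  refine finsum_pow_unl_eq (RootedGregTree.family_injective _) RootedGregTree.family_mem
    (fun F hF => ?_) RootedGregTree.card_family
  obtain ⟨T, hT⟩ := RootedGregTreeRep.exists_family_eq (mem_gregFamilies.1 hF)
  exact ⟨Quotient.mk _ T, hT⟩

lemma GregTree.finsum_pow_unl (m : ℕ) : Finite (GregTree (m + 1)) ∧
    ∑ᶠ T : GregTree (m + 1), (X : ℂ[X]) ^ T.unl = hPoly m := by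
  classical
  have hn : 0 < m + 1 := m.succ_pos
  rw [← sum_gregFamilies_zeroTop]
  refine finsum_pow_unl_eq ((RootedGregTree.family_injective _).comp (GregTree.rooted_injective hn))
    (u := GregTree.unl) (fun T => ?_) (fun F hF => ?_) fun T => ?_
  · rw [Function.comp_apply]
    convert GregTree.family_rooted_mem hn T
  · exact GregTree.exists_family_rooted_eq hn (by convert hF)
  · exact (RootedGregTree.card_family _).trans (by
      rw [GregTree.unl_rooted])

theorem mainTheorem1 (n : ℕ) (hn : 1 ≤ n) :
    Finite (RootedGregTree n) ∧ Finite (GregTree n) ∧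
    (∃! G : ℂ[X], IsGPoly n G) ∧ (∃! H : ℂ[X], IsHPoly n H) ∧
    (∀ G : ℂ[X], IsGPoly n G → G = ∑ᶠ T : RootedGregTree n, (X : ℂ[X]) ^ T.unl) ∧
    (∀ H : ℂ[X], IsHPoly n H → H = ∑ᶠ T : GregTree n, (X : ℂ[X]) ^ T.unl) := by
  obtain ⟨m, rfl⟩ := Nat.exists_eq_add_of_le' hn
  obtain ⟨hfinG, hG⟩ := RootedGregTree.finsum_pow_unl m
  obtain ⟨hfinH, hH⟩ := GregTree.finsum_pow_unl m
  refine ⟨hfinG, hfinH, ⟨gPoly m, isGPoly_gPoly m, fun P hP => hP.unique (isGPoly_gPoly m)⟩,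
    ⟨hPoly m, isHPoly_hPoly m, fun P hP => hP.unique (isHPoly_hPoly m)⟩, fun P hP => ?_,
    fun P hP => ?_⟩
  · rw [hG, hP.unique (isGPoly_gPoly m)]
  · rw [hH, hP.unique (isHPoly_hPoly m)]
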